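/- Let $G$ be a diffeological group, i.e. a group with a diffeology for which multiplication and inversion are smooth. Subsets, products and quotients carry the subset, product and quotient diffeologies. Let $EG$ be the join of countably many copies of $G$: the quotient of $$S_G=\Big\{(t_i,g_i)_{i\in\mathbb N}\in[0,1]^{\mathbb N}\times G^{\mathbb N} : \text{only finitely many } t_i\neq 0,\ \sum_i t_i=1\Big\}$$ by the relation $(t_i,g_i)\sim(t'_i,g'_i)$ if $t_i=t'_i$ for all $i$ and $g_i=g'_i$ whenever $t_i\neq 0$. The group $G$ acts on $EG$ by $h\cdot(t_ig_i)=(t_ig_ih^{-1})$, and $BG=EG/G$ is the (diffeological) Milnor classifying space. For a diffeological space $X$, let $\pi_0(X)$ be the set of smooth path components (two points are equivalent if they are $\gamma(0)$ and $\gamma(1)$ for a smooth $\gamma\colon\mathbb R\to X$). For $x\in X$ let $\operatorname{Loops}(X,x)$ be the space of smooth maps $\gamma\colon\mathbb R\to X$ with $\gamma(0)=\gamma(1)=x$, with the functional diffeology and the constant loop $\hat x$ as base point. Put $\pi_0(X,x)=\pi_0(X)$ and $\pi_k(X,x)=\pi_{k-1}(\operatorname{Loops}(X,x),\hat x)$ for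 $k\ge 1$; for $k\geq 1$ this is a group under concatenation of loops (made stationary near their ends), and $\pi_0(G)$ is a group under the multiplication of $G$. Then for every $k>0$ and all base points $b\in BG$ and $g\in G$ there is an isomorphism of groups $$\pi_k(BG,b)\cong\pi_{k-1}(G,g),$$ where for $k=1$ the right-hand side is the group $\pi_0(G)$. -/

import Mathlib

open scoped Topology ContDiff

noncomputable section

namespace Diffeology

universe u v

/-! ### Standard constructions of diffeologies -/

/-- A map that agrees near every point with some plot is a plot (sheaf condition). -/
theorem isPlot_of_eventuallyEq {X : Type*} [DiffeologicalSpace X] {n : ℕ}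
    {p : EuclideanSpace ℝ (Fin n) → X}
    (h : ∀ r, ∃ q : EuclideanSpace ℝ (Fin n) → X, IsPlot q ∧ ∀ᶠ r' in 𝓝 r, p r' = q r') :
    IsPlot p := by
  refine DiffeologicalSpace.locality fun r => ?_
  obtain ⟨q, hq, hpq⟩ := h r
  obtain ⟨U, hU, hUo, hr⟩ := eventually_nhds_iff.1 hpq
  refine ⟨U, hUo, hr, fun {m f} hf hfs => ?_⟩
  have : p ∘ f = q ∘ f := funext fun x => hU _ (hf x)
  rw [this]
  exact isPlot_reparam hq hfs

/-- The subset diffeology: plots are the plots of the ambient space with values in the subset. -/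
instance {X : Type*} [DiffeologicalSpace X] {P : X → Prop} : DiffeologicalSpace (Subtype P) where
  plots n := {p | IsPlot fun r => (p r : X)}
  constant_plots x := isPlot_const
  plot_reparam hp hf := isPlot_reparam hp hf
  locality {n p} hp := by
    refine DiffeologicalSpace.locality (p := fun r => (p r : X)) fun r => ?_
    obtain ⟨U, hU, hr, h⟩ := hp r
    exact ⟨U, hU, hr, fun {m f} hf hfs => h hf hfs⟩

/-- The product diffeology on a binary product. -/
instance {X Y : Type*} [DiffeologicalSpace X] [DiffeologicalSpace Y] :
    DiffeologicalSpace (X × Y) where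
  plots n := {p | (IsPlot fun r => (p r).1) ∧ IsPlot fun r => (p r).2}
  constant_plots x := ⟨isPlot_const, isPlot_const⟩
  plot_reparam hp hf := ⟨isPlot_reparam hp.1 hf, isPlot_reparam hp.2 hf⟩
  locality {n p} hp := by
    constructor
    · refine DiffeologicalSpace.locality (p := fun r => (p r).1) fun r => ?_
      obtain ⟨U, hU, hr, h⟩ := hp r
      exact ⟨U, hU, hr, fun {m f} hf hfs => (h hf hfs).1⟩
    · refine DiffeologicalSpace.locality (p := fun r => (p r).2) fun r => ?_
      obtain ⟨U, hU, hr, h⟩ := hp r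
      exact ⟨U, hU, hr, fun {m f} hf hfs => (h hf hfs).2⟩

/-- The product diffeology on an arbitrary product. -/
instance {ι : Type*} {X : ι → Type*} [∀ i, DiffeologicalSpace (X i)] :
    DiffeologicalSpace (∀ i, X i) where
  plots n := {p | ∀ i, IsPlot fun r => p r i}
  constant_plots x := fun _ => isPlot_const
  plot_reparam hp hf := fun i => isPlot_reparam (hp i) hf
  locality {n p} hp := by
    intro i
    refine DiffeologicalSpace.locality (p := fun r => p r i) fun r => ?_
    obtain ⟨U, hU, hr, h⟩ := hp r
    exact ⟨U, hU, hr, fun {m f} hf hfs => h hf hfs i⟩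

/-- Around each point of `ℝⁿ`, every neighbourhood contains the image of a smooth self-map of `ℝⁿ`
that is the identity near the point. -/
theorem exists_smooth_localization {n : ℕ} (x : EuclideanSpace ℝ (Fin n))
    {U : Set (EuclideanSpace ℝ (Fin n))} (hU : IsOpen U) (hx : x ∈ U) :
    ∃ f : EuclideanSpace ℝ (Fin n) → EuclideanSpace ℝ (Fin n),
      ContDiff ℝ ∞ f ∧ (∀ y, f y ∈ U) ∧ ∀ᶠ y in 𝓝 x, f y = y := by
  obtain ⟨ε, hε, hball⟩ := Metric.isOpen_iff.1 hU x hx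
  let φ : ContDiffBump x := ⟨ε / 2, ε, by positivity, by linarith⟩
  refine ⟨fun y => x + φ y • (y - x), ?_, fun y => hball ?_, ?_⟩
  · exact contDiff_const.add (φ.contDiff.smul (contDiff_id.sub contDiff_const))
  · rw [Metric.mem_ball, dist_eq_norm, add_sub_cancel_left, norm_smul, Real.norm_eq_abs,
      abs_of_nonneg φ.nonneg]
    by_cases hy : dist y x < ε
    · rw [dist_eq_norm] at hy
      calc φ y * ‖y - x‖ ≤ 1 * ‖y - x‖ := by gcongr; exact φ.le_one
        _ < ε := by linarith
    · rw [φ.zero_of_le_dist (not_lt.1 hy)]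
      simpa using hε
  · filter_upwards [φ.eventuallyEq_one] with y hy
    rw [hy]; simp

/-- The quotient diffeology: plots are the maps that lift, locally around every point, to plots of
the original space. (By `exists_smooth_localization`, it makes no difference whether the local
lifts are defined on a neighbourhood only or on all of `ℝⁿ`.) -/
instance {X : Type*} [DiffeologicalSpace X] {s : Setoid X} : DiffeologicalSpace (Quotient s) where
  plots n := {p | ∀ r, ∃ q : EuclideanSpace ℝ (Fin n) → X,
    IsPlot q ∧ ∀ᶠ r' in 𝓝 r, p r' = Quotient.mk s (q r')}
  constant_plots x := by
    intro r
    obtain ⟨y, rfl⟩ := Quotient.exists_rep x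
    exact ⟨fun _ => y, isPlot_const, by simp⟩
  plot_reparam {n m p f} hp hf := by
    intro r
    obtain ⟨q, hq, h⟩ := hp (f r)
    exact ⟨q ∘ f, isPlot_reparam hq hf, hf.continuous.continuousAt.eventually h⟩
  locality {n p} hp := by
    intro r
    obtain ⟨U, hU, hr, h⟩ := hp r
    obtain ⟨f, hf, hfU, hfr⟩ := exists_smooth_localization r hU hr
    obtain ⟨q, hq, hq'⟩ := h hfU hf r
    refine ⟨q, hq, ?_⟩
    filter_upwards [hq', hfr] with y h1 h2
    rw [← h1, Function.comp_apply, h2]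

theorem dSmooth_fst {X Y : Type*} [DiffeologicalSpace X] [DiffeologicalSpace Y] :
    DSmooth (Prod.fst : X × Y → X) := fun _ _ hp => hp.1

theorem dSmooth_snd {X Y : Type*} [DiffeologicalSpace X] [DiffeologicalSpace Y] :
    DSmooth (Prod.snd : X × Y → Y) := fun _ _ hp => hp.2

theorem DSmooth.prodMk {X Y Z : Type*} [DiffeologicalSpace X] [DiffeologicalSpace Y]
    [DiffeologicalSpace Z] {f : Z → X} {g : Z → Y} (hf : DSmooth f) (hg : DSmooth g) :
    DSmooth fun z => (f z, g z) := fun _ _ hp => ⟨hf _ _ hp, hg _ _ hp⟩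

instance : IsContDiffCompatible (ℝ × ℝ) where
  isPlot_iff {n p} := by
    rw [contDiff_prod_iff]
    exact and_congr isPlot_iff_contDiff isPlot_iff_contDiff

/-- Gluing of two smooth maps along overlapping open sublevel and superlevel sets. -/
theorem dSmooth_glue {X Y : Type*} [DiffeologicalSpace X] [DiffeologicalSpace Y] {c : Y → ℝ}
    (hc : DSmooth c) {a b : ℝ} (hab : a < b) {F F₁ F₂ : Y → X} (h₁ : DSmooth F₁)
    (h₂ : DSmooth F₂) (e₁ : ∀ y, c y < b → F y = F₁ y) (e₂ : ∀ y, a < c y → F y = F₂ y) :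
    DSmooth F := by
  intro n p hp
  have hcont : Continuous fun r => c (p r) := (hc _ _ hp).contDiff.continuous
  refine isPlot_of_eventuallyEq fun r => ?_
  rcases lt_or_ge (c (p r)) b with h | h
  · exact ⟨F₁ ∘ p, h₁ _ _ hp, (hcont.continuousAt.eventually_lt_const h).mono fun y hy => e₁ _ hy⟩
  · exact ⟨F₂ ∘ p, h₂ _ _ hp,
      (hcont.continuousAt.eventually_const_lt (hab.trans_le h)).mono fun y hy => e₂ _ hy⟩

/-! ### Concatenation of smooth paths -/

/-- A smooth cut-off function `ℝ → [0,1]`, equal to `0` on `(-∞, 1/3]` and to `1` on `[2/3, ∞)`. -/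
def cut (t : ℝ) : ℝ := Real.smoothTransition (3 * t - 1)

theorem cut_contDiff : ContDiff ℝ ∞ cut :=
  Real.smoothTransition.contDiff.comp ((contDiff_const.mul contDiff_id).sub contDiff_const)

theorem cut_eq_zero {t : ℝ} (h : t ≤ 1 / 3) : cut t = 0 :=
  Real.smoothTransition.zero_of_nonpos (by linarith)

theorem cut_eq_one {t : ℝ} (h : 2 / 3 ≤ t) : cut t = 1 :=
  Real.smoothTransition.one_of_one_le (by linarith)

theorem cut_nonneg (t : ℝ) : 0 ≤ cut t := Real.smoothTransition.nonneg _

theorem cut_le_one (t : ℝ) : cut t ≤ 1 := Real.smoothTransition.le_one _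

/-- The path that runs through `α` on `[0, 1]` and through `β` on `[1, 2]`, where both are first
made stationary near their ends by the cut-off function. -/
def joinPath {X : Type*} (α β : ℝ → X) (t : ℝ) : X :=
  if t ≤ 1 then α (cut t) else β (cut (t - 1))

theorem joinPath_of_lt {X : Type*} {α β : ℝ → X} (h : α 1 = β 0) {t : ℝ} (ht : t < 4 / 3) :
    joinPath α β t = α (cut t) := by
  unfold joinPath
  split_ifs with h1
  · rfl
  · rw [cut_eq_zero (by linarith), cut_eq_one (by linarith), h]

theorem joinPath_of_gt {X : Type*} {α β : ℝ → X} (h : α 1 = β 0) {t : ℝ} (ht : 2 / 3 < t) :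
    joinPath α β t = β (cut (t - 1)) := by
  unfold joinPath
  split_ifs with h1
  · rw [cut_eq_one (by linarith), cut_eq_zero (by linarith), h]
  · rfl

theorem joinPath_dSmooth {X : Type*} [DiffeologicalSpace X] {α β : ℝ → X} (hα : DSmooth α)
    (hβ : DSmooth β) (h : α 1 = β 0) : DSmooth (joinPath α β) := by
  refine dSmooth_glue (c := fun t : ℝ => t) (a := 2 / 3) (b := 4 / 3) dSmooth_id' (by norm_num)
    (F₁ := fun t => α (cut t)) (F₂ := fun t => β (cut (t - 1))) ?_ ?_
    (fun t ht => joinPath_of_lt h ht) (fun t ht => joinPath_of_gt h ht)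
  · exact hα.comp cut_contDiff.dSmooth
  · exact hβ.comp (cut_contDiff.comp (contDiff_id.sub contDiff_const)).dSmooth

/-! ### Smooth path components -/

/-- Two points are connected if they are the values at `0` and `1` of a smooth path `ℝ → X`. -/
def SmoothlyConnected {X : Type*} [DiffeologicalSpace X] (x y : X) : Prop :=
  ∃ γ : ℝ → X, DSmooth γ ∧ γ 0 = x ∧ γ 1 = y

theorem smoothlyConnected_equivalence (X : Type*) [DiffeologicalSpace X] :
    Equivalence (SmoothlyConnected (X := X)) where
  refl x := ⟨fun _ => x, dSmooth_const, rfl, rfl⟩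
  symm := by
    rintro x y ⟨γ, hγ, h0, h1⟩
    refine ⟨fun t => γ (1 - t), ?_, by simpa using h1, by simpa using h0⟩
    exact hγ.comp (contDiff_const.sub contDiff_id).dSmooth
  trans := by
    rintro x y z ⟨γ, hγ, h0, h1⟩ ⟨δ, hδ, k0, k1⟩
    have h : γ 1 = δ 0 := h1.trans k0.symm
    refine ⟨fun t => joinPath γ δ (2 * t), ?_, ?_, ?_⟩
    · exact (joinPath_dSmooth hγ hδ h).comp (contDiff_const.mul contDiff_id).dSmooth
    · change joinPath γ δ (2 * 0) = x
      rw [joinPath_of_lt h (by norm_num), cut_eq_zero (by norm_num), h0]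
    · change joinPath γ δ (2 * 1) = z
      rw [joinPath_of_gt h (by norm_num), cut_eq_one (by norm_num), k1]

/-- The equivalence relation whose classes are the smooth path components. -/
def pathSetoid (X : Type*) [DiffeologicalSpace X] : Setoid X :=
  ⟨SmoothlyConnected, smoothlyConnected_equivalence X⟩

/-- `π₀(X)`: the set of smooth path components. -/
def PiZero (X : Type u) [DiffeologicalSpace X] : Type u := Quotient (pathSetoid X)

theorem SmoothlyConnected.map₂ {X Y Z : Type*} [DiffeologicalSpace X] [DiffeologicalSpace Y]
    [DiffeologicalSpace Z] {f : X → Y → Z} (hf : DSmooth fun p : X × Y => f p.1 p.2) {x x' : X}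
    {y y' : Y} (hx : SmoothlyConnected x x') (hy : SmoothlyConnected y y') :
    SmoothlyConnected (f x y) (f x' y') := by
  obtain ⟨γ, hγ, rfl, rfl⟩ := hx
  obtain ⟨δ, hδ, rfl, rfl⟩ := hy
  exact ⟨fun t => f (γ t) (δ t), hf.comp (hγ.prodMk hδ), rfl, rfl⟩

theorem SmoothlyConnected.map {X Y : Type*} [DiffeologicalSpace X] [DiffeologicalSpace Y]
    {f : X → Y} (hf : DSmooth f) {x x' : X} (hx : SmoothlyConnected x x') :
    SmoothlyConnected (f x) (f x') := by
  obtain ⟨γ, hγ, rfl, rfl⟩ := hx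
  exact ⟨fun t => f (γ t), hf.comp hγ, rfl, rfl⟩

/-! ### Loop spaces -/

/-- The smooth loops of `X` at `x`: smooth paths `ℝ → X` with value `x` at `0` and at `1`. -/
@[ext]
structure Loops {X : Type u} [DiffeologicalSpace X] (x : X) : Type u where
  toFun : ℝ → X
  smooth : DSmooth toFun
  source : toFun 0 = x
  target : toFun 1 = x

/-- The functional diffeology on a loop space: `P` is a plot if `(r, t) ↦ P r t` is smooth. -/
instance {X : Type u} [DiffeologicalSpace X] (x : X) : DiffeologicalSpace (Loops x) where
  plots n := {P | DSmooth fun q : EuclideanSpace ℝ (Fin n) × ℝ => (P q.1).toFun q.2}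
  constant_plots γ := γ.smooth.comp dSmooth_snd
  plot_reparam {n m P f} hP hf := by
    have : DSmooth fun q : EuclideanSpace ℝ (Fin n) × ℝ => (f q.1, q.2) :=
      (hf.dSmooth.comp dSmooth_fst).prodMk dSmooth_snd
    exact DSmooth.comp hP this
  locality {n P} hP := by
    intro m p hp
    refine DiffeologicalSpace.locality fun r => ?_
    have h1 : ContDiff ℝ ∞ fun r => (p r).1 := isPlot_iff_contDiff.1 hp.1
    obtain ⟨U, hU, hr, h⟩ := hP (p r).1
    refine ⟨(fun r => (p r).1) ⁻¹' U, hU.preimage h1.continuous, hr, fun {k f} hf hfs => ?_⟩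
    have h2 : IsPlot fun y => (p (f y)).2 := isPlot_reparam hp.2 hfs
    have h3 : DSmooth fun q : EuclideanSpace ℝ (Fin k) × ℝ => (P (p (f q.1)).1).toFun q.2 :=
      h (f := fun y => (p (f y)).1) hf (h1.comp hfs)
    exact DSmooth.isPlot (h3.comp' (dSmooth_id.prodMk h2.dSmooth))

/-- The constant loop. -/
def Loops.const {X : Type u} [DiffeologicalSpace X] (x : X) : Loops x :=
  ⟨fun _ => x, dSmooth_const, rfl, rfl⟩

/-- A map into a loop space is smooth if and only if its uncurried form is smooth. -/
theorem Loops.dSmooth_iff {X A : Type*} [DiffeologicalSpace X] [DiffeologicalSpace A] {x : X}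
    {Γ : A → Loops x} : DSmooth Γ ↔ DSmooth fun q : A × ℝ => (Γ q.1).toFun q.2 := by
  constructor
  · intro h n p hp
    have h1 : DSmooth fun q : EuclideanSpace ℝ (Fin n) × ℝ => (Γ (p q.1).1).toFun q.2 :=
      h _ _ hp.1
    have h2 : DSmooth fun r => (p r).2 := IsPlot.dSmooth hp.2
    exact DSmooth.isPlot (h1.comp' (dSmooth_id.prodMk h2))
  · intro h n p hp
    exact DSmooth.comp h ((hp.dSmooth.comp dSmooth_fst).prodMk dSmooth_snd)

/-- Concatenation of loops: first `α`, then `β`, both made stationary near their ends. -/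
def Loops.concat {X : Type u} [DiffeologicalSpace X] {x : X} (α β : Loops x) : Loops x where
  toFun t := joinPath α.toFun β.toFun (2 * t)
  smooth := (joinPath_dSmooth α.smooth β.smooth (α.target.trans β.source.symm)).comp
    (contDiff_const.mul contDiff_id).dSmooth
  source := by
    rw [joinPath_of_lt (α.target.trans β.source.symm) (by norm_num), cut_eq_zero (by norm_num),
      α.source]
  target := by
    rw [joinPath_of_gt (α.target.trans β.source.symm) (by norm_num), cut_eq_one (by norm_num),
      β.target]

/-- The reversed loop. -/
def Loops.rev {X : Type u} [DiffeologicalSpace X] {x : X} (α : Loops x) : Loops x where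
  toFun t := α.toFun (1 - t)
  smooth := α.smooth.comp (contDiff_const.sub contDiff_id).dSmooth
  source := by simpa using α.target
  target := by simpa using α.source

theorem Loops.dSmooth_rev {X : Type*} [DiffeologicalSpace X] {x : X} :
    DSmooth (Loops.rev (x := x)) := by
  have hev := Loops.dSmooth_iff.1 (dSmooth_id (X := Loops x))
  refine Loops.dSmooth_iff.2 ?_
  have hc : DSmooth fun t : ℝ => 1 - t := (contDiff_const.sub contDiff_id).dSmooth
  exact hev.comp (dSmooth_fst.prodMk (hc.comp dSmooth_snd))

theorem Loops.dSmooth_concat {X : Type*} [DiffeologicalSpace X] {x : X} :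
    DSmooth fun p : Loops x × Loops x => p.1.concat p.2 := by
  have hev := Loops.dSmooth_iff.1 (dSmooth_id (X := Loops x))
  refine Loops.dSmooth_iff.2 ?_
  have hc : DSmooth fun t : ℝ => 2 * t := (contDiff_const.mul contDiff_id).dSmooth
  have hd₁ : DSmooth fun t : ℝ => cut (2 * t) := cut_contDiff.dSmooth.comp hc
  have hd₂ : DSmooth fun t : ℝ => cut (2 * t - 1) :=
    (cut_contDiff.comp ((contDiff_const.mul contDiff_id).sub contDiff_const)).dSmooth
  refine dSmooth_glue (c := fun q : (Loops x × Loops x) × ℝ => 2 * q.2) (hc.comp dSmooth_snd)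
    (a := 2 / 3) (b := 4 / 3) (by norm_num)
    (F₁ := fun q => q.1.1.toFun (cut (2 * q.2))) (F₂ := fun q => q.1.2.toFun (cut (2 * q.2 - 1)))
    ?_ ?_ (fun q hq => joinPath_of_lt (q.1.1.target.trans q.1.2.source.symm) hq)
    (fun q hq => joinPath_of_gt (q.1.1.target.trans q.1.2.source.symm) hq)
  · exact hev.comp ((dSmooth_fst.comp dSmooth_fst).prodMk (hd₁.comp dSmooth_snd))
  · exact hev.comp ((dSmooth_snd.comp dSmooth_fst).prodMk (hd₂.comp dSmooth_snd))

/-- Two loops that are reparametrizations of one path by homotopic parameters are connected. -/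
theorem Loops.connected_of_reparam {X : Type*} [DiffeologicalSpace X] {x : X} {α β : Loops x}
    {D : ℝ → X} (hD : DSmooth D) {w w' : ℝ → ℝ} (hw : ContDiff ℝ ∞ w) (hw' : ContDiff ℝ ∞ w')
    (h0 : w 0 = w' 0) (h1 : w 1 = w' 1) (hα : ∀ t, α.toFun t = D (w t))
    (hβ : ∀ t, β.toFun t = D (w' t)) : SmoothlyConnected α β := by
  let H : ℝ × ℝ → ℝ := fun q => w q.2 + q.1 * (w' q.2 - w q.2)
  have hH : ContDiff ℝ ∞ H := by
    have a := hw.comp (contDiff_snd (𝕜 := ℝ) (E := ℝ) (F := ℝ))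
    have b := hw'.comp (contDiff_snd (𝕜 := ℝ) (E := ℝ) (F := ℝ))
    exact a.add (contDiff_fst.mul (b.sub a))
  have hDH : DSmooth fun q : ℝ × ℝ => D (H q) := hD.comp hH.dSmooth
  refine ⟨fun s => ⟨fun t => D (H (s, t)), ?_, ?_, ?_⟩, ?_, ?_, ?_⟩
  · exact hDH.comp (dSmooth_const.prodMk dSmooth_id)
  · have : H (s, 0) = w 0 := by simp [H, h0]
    rw [this, ← hα, α.source]
  · have : H (s, 1) = w 1 := by simp [H, h1]
    rw [this, ← hα, α.target]
  · exact Loops.dSmooth_iff.2 hDH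
  · ext t; simp [H, hα]
  · ext t; simp [H, hβ]

theorem Loops.const_concat {X : Type*} [DiffeologicalSpace X] {x : X} (α : Loops x) :
    SmoothlyConnected ((Loops.const x).concat α) α := by
  refine Loops.connected_of_reparam α.smooth (w := fun t => cut (2 * t - 1)) (w' := fun t => t)
    (cut_contDiff.comp ((contDiff_const.mul contDiff_id).sub contDiff_const)) contDiff_id
    (cut_eq_zero (by norm_num)) (cut_eq_one (by norm_num)) (fun t => ?_) (fun t => rfl)
  change joinPath _ _ _ = _
  unfold joinPath
  split_ifs with h
  · rw [cut_eq_zero (t := 2 * t - 1) (by linarith), α.source]; rfl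
  · rfl

theorem Loops.concat_const {X : Type*} [DiffeologicalSpace X] {x : X} (α : Loops x) :
    SmoothlyConnected (α.concat (Loops.const x)) α := by
  refine Loops.connected_of_reparam α.smooth (w := fun t => cut (2 * t)) (w' := fun t => t)
    (cut_contDiff.comp (contDiff_const.mul contDiff_id)) contDiff_id
    (cut_eq_zero (by norm_num)) (cut_eq_one (by norm_num)) (fun t => ?_) (fun t => rfl)
  change joinPath _ _ _ = _
  unfold joinPath
  split_ifs with h
  · rfl
  · rw [cut_eq_one (t := 2 * t) (by linarith), α.target]; rfl

theorem Loops.rev_concat {X : Type*} [DiffeologicalSpace X] {x : X} (α : Loops x) :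
    SmoothlyConnected (α.rev.concat α) (Loops.const x) := by
  refine Loops.connected_of_reparam α.smooth (w := fun t => 1 - cut (2 * t) + cut (2 * t - 1))
    (w' := fun _ => 1) ?_ contDiff_const ?_ ?_ (fun t => ?_) (fun t => α.target.symm)
  · exact (contDiff_const.sub (cut_contDiff.comp (contDiff_const.mul contDiff_id))).add
      (cut_contDiff.comp ((contDiff_const.mul contDiff_id).sub contDiff_const))
  · rw [cut_eq_zero (by norm_num), cut_eq_zero (by norm_num)]; norm_num
  · rw [cut_eq_one (by norm_num), cut_eq_one (by norm_num)]; norm_num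
  · change joinPath _ _ _ = _
    unfold joinPath
    split_ifs with h
    · rw [cut_eq_zero (t := 2 * t - 1) (by linarith), add_zero]; rfl
    · rw [cut_eq_one (t := 2 * t) (by linarith), sub_self, zero_add]

/-- A smooth function that vanishes on `(-∞, 0]` and is the identity on `[1/6, ∞)`. -/
def flatId (v : ℝ) : ℝ := v * Real.smoothTransition (6 * v)

theorem flatId_contDiff : ContDiff ℝ ∞ flatId :=
  contDiff_id.mul (Real.smoothTransition.contDiff.comp (contDiff_const.mul contDiff_id))

theorem flatId_of_nonpos {v : ℝ} (h : v ≤ 0) : flatId v = 0 := by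
  rw [flatId, Real.smoothTransition.zero_of_nonpos (by linarith), mul_zero]

theorem flatId_of_ge {v : ℝ} (h : 1 / 6 ≤ v) : flatId v = v := by
  rw [flatId, Real.smoothTransition.one_of_one_le (by linarith), mul_one]

theorem flatId_nonneg (v : ℝ) : 0 ≤ flatId v := by
  rcases le_total v 0 with h | h
  · rw [flatId_of_nonpos h]
  · exact mul_nonneg h (Real.smoothTransition.nonneg _)

theorem flatId_le {v : ℝ} (h : v ≤ 1 / 6) : flatId v ≤ 1 / 6 := by
  rcases le_total v 0 with h' | h'
  · rw [flatId_of_nonpos h']; norm_num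
  · have := Real.smoothTransition.le_one (6 * v)
    calc flatId v ≤ v * 1 := mul_le_mul_of_nonneg_left this h'
      _ ≤ 1 / 6 := by linarith

theorem cut_flatId (v : ℝ) : cut (flatId v) = cut v := by
  rcases le_total v (1 / 6) with h | h
  · rw [cut_eq_zero (t := v) (by linarith), cut_eq_zero (by linarith [flatId_le h])]
  · rw [flatId_of_ge h]

theorem cut_one_sub_flatId (v : ℝ) : cut (1 - flatId (1 - v)) = cut v := by
  rcases le_total (1 - v) (1 / 6) with h | h
  · rw [cut_eq_one (t := v) (by linarith), cut_eq_one (by linarith [flatId_le h])]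
  · rw [flatId_of_ge h, sub_sub_cancel]

theorem Loops.concat_assoc {X : Type*} [DiffeologicalSpace X] {x : X} (α β γ : Loops x) :
    SmoothlyConnected ((α.concat β).concat γ) (α.concat (β.concat γ)) := by
  have hαβ : α.toFun 1 = β.toFun 0 := α.target.trans β.source.symm
  have hβγ : β.toFun 1 = γ.toFun 0 := β.target.trans γ.source.symm
  let D : ℝ → X := fun u =>
    if u ≤ 2 then joinPath α.toFun β.toFun u else γ.toFun (cut (u - 2))
  have hD : DSmooth D := by
    refine dSmooth_glue (c := fun t : ℝ => t) (a := 5 / 3) (b := 7 / 3) dSmooth_id' (by norm_num)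
      (F₁ := joinPath α.toFun β.toFun) (F₂ := fun t => γ.toFun (cut (t - 2)))
      (joinPath_dSmooth α.smooth β.smooth hαβ)
      (γ.smooth.comp (cut_contDiff.comp (contDiff_id.sub contDiff_const)).dSmooth)
      (fun t ht => ?_) (fun t ht => ?_)
    · by_cases h : t ≤ 2
      · simp [D, h]
      · rw [joinPath_of_gt hαβ (by linarith), cut_eq_one (by linarith)]
        simp only [D, h, if_false]
        rw [cut_eq_zero (by linarith), hβγ]
    · by_cases h : t ≤ 2
      · simp only [D, h, if_true]
        rw [joinPath_of_gt hαβ (by linarith), cut_eq_one (by linarith),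
          cut_eq_zero (by linarith), hβγ]
      · simp [D, h]
  have hD₁ : ∀ u, u ≤ 1 → D u = α.toFun (cut u) := fun u hu => by
    simp only [D, if_pos (hu.trans one_le_two)]
    exact joinPath_of_lt hαβ (by linarith)
  have hD₂ : ∀ u, 1 ≤ u → D u = joinPath β.toFun γ.toFun (u - 1) := fun u hu => by
    by_cases h : u ≤ 2
    · simp only [D, if_pos h]
      rw [joinPath_of_gt hαβ (by linarith), joinPath_of_lt hβγ (by linarith)]
    · simp only [D, if_neg h]
      rw [joinPath_of_gt hβγ (by linarith), sub_sub]; norm_num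
  have c2 : ContDiff ℝ ∞ fun t : ℝ => 2 * t := contDiff_const.mul contDiff_id
  have c21 : ContDiff ℝ ∞ fun t : ℝ => 2 * t - 1 := c2.sub contDiff_const
  refine Loops.connected_of_reparam hD
    (w := fun t => 2 * cut (2 * t) + flatId (2 * t - 1))
    (w' := fun t => (1 - flatId (1 - 2 * t)) + 2 * cut (2 * t - 1))
    ((contDiff_const.mul (cut_contDiff.comp c2)).add (flatId_contDiff.comp c21))
    ((contDiff_const.sub (flatId_contDiff.comp (contDiff_const.sub c2))).add
      (contDiff_const.mul (cut_contDiff.comp c21))) ?_ ?_ (fun t => ?_) (fun t => ?_)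
  · rw [cut_eq_zero (by norm_num), cut_eq_zero (by norm_num), flatId_of_nonpos (by norm_num),
      flatId_of_ge (by norm_num)]
    norm_num
  · rw [cut_eq_one (by norm_num), cut_eq_one (by norm_num), flatId_of_nonpos (v := 1 - 2 * 1)
      (by norm_num), flatId_of_ge (by norm_num)]
    norm_num
  · change (if 2 * t ≤ 1 then joinPath α.toFun β.toFun (2 * cut (2 * t))
      else γ.toFun (cut (2 * t - 1))) = _
    split_ifs with h
    · rw [flatId_of_nonpos (by linarith), add_zero]
      simp only [D]
      rw [if_pos (by linarith [cut_le_one (2 * t)])]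
    · rw [cut_eq_one (t := 2 * t) (by linarith), mul_one]
      have hn := flatId_nonneg (2 * t - 1)
      rw [hD₂ _ (by linarith), joinPath_of_gt hβγ (by linarith), ← cut_flatId]
      congr 2; ring
  · change (if 2 * t ≤ 1 then α.toFun (cut (2 * t))
      else joinPath β.toFun γ.toFun (2 * cut (2 * t - 1))) = _
    split_ifs with h
    · rw [cut_eq_zero (t := 2 * t - 1) (by linarith), mul_zero, add_zero,
        hD₁ _ (by linarith [flatId_nonneg (1 - 2 * t)]), cut_one_sub_flatId]
    · rw [flatId_of_nonpos (by linarith), hD₂ _ (by linarith [cut_nonneg (2 * t - 1)])]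
      congr 1; ring

/-- The group structure on `π₀` of a loop space, induced by concatenation of loops. -/
instance PiZero.instGroupLoops {X : Type u} [DiffeologicalSpace X] (x : X) :
    Group (PiZero (Loops x)) where
  mul := Quotient.map₂ Loops.concat fun _ _ h _ _ h' => h.map₂ Loops.dSmooth_concat h'
  one := Quotient.mk _ (Loops.const x)
  inv := Quotient.map Loops.rev fun _ _ h => h.map Loops.dSmooth_rev
  mul_assoc := by
    rintro ⟨a⟩ ⟨b⟩ ⟨c⟩
    exact Quotient.sound (Loops.concat_assoc a b c)
  one_mul := by
    rintro ⟨a⟩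
    exact Quotient.sound (Loops.const_concat a)
  mul_one := by
    rintro ⟨a⟩
    exact Quotient.sound (Loops.concat_const a)
  inv_mul_cancel := by
    rintro ⟨a⟩
    exact Quotient.sound (Loops.rev_concat a)

/-! ### Homotopy groups -/

/-- The `n`-th diffeological homotopy set `πₙ(X, x)`: the set `π₀(X)` for `n = 0`, and
`πₙ₊₁(X, x) = πₙ(Loops x, const x)`. -/
def HomotopyPi : (n : ℕ) → {X : Type u} → [DiffeologicalSpace X] → X → Type u
  | 0, X, _, _ => PiZero X
  | n + 1, _, _, x => HomotopyPi n (Loops.const x)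

/-- The group structure on `πₙ₊₁(X, x) = π₀(Loopsⁿ⁺¹(X, x))`, given by concatenation of loops in
`Loopsⁿ(X, x)`. -/
instance HomotopyPi.group : (n : ℕ) → {X : Type u} → [DiffeologicalSpace X] → (x : X) →
    Group (HomotopyPi (n + 1) x)
  | 0, _, _, x => PiZero.instGroupLoops x
  | n + 1, _, _, x => HomotopyPi.group n (Loops.const x)

/-! ### Diffeological groups and the Milnor classifying space -/

/-- A diffeological group: multiplication and inversion are smooth. -/
class DiffeologicalGroup (G : Type u) [Group G] [DiffeologicalSpace G] : Prop where
  smooth_mul : DSmooth fun p : G × G => p.1 * p.2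
  smooth_inv : DSmooth fun g : G => g⁻¹

/-- The group structure on `π₀(G)` induced by that of a diffeological group `G`. -/
instance PiZero.instGroup {G : Type u} [Group G] [DiffeologicalSpace G] [DiffeologicalGroup G] :
    Group (PiZero G) where
  mul := Quotient.map₂ (· * ·) fun _ _ h _ _ h' => h.map₂ DiffeologicalGroup.smooth_mul h'
  one := Quotient.mk _ 1
  inv := Quotient.map (·⁻¹) fun _ _ h => h.map DiffeologicalGroup.smooth_inv
  mul_assoc := by
    rintro ⟨a⟩ ⟨b⟩ ⟨c⟩
    exact congrArg (Quotient.mk _) (mul_assoc a b c)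
  one_mul := by
    rintro ⟨a⟩
    exact congrArg (Quotient.mk _) (one_mul a)
  mul_one := by
    rintro ⟨a⟩
    exact congrArg (Quotient.mk _) (mul_one a)
  inv_mul_cancel := by
    rintro ⟨a⟩
    exact congrArg (Quotient.mk _) (inv_mul_cancel a)

/-- The sequences `(tᵢ, xᵢ)` with `tᵢ ∈ [0,1]`, only finitely many `tᵢ` non-zero and `∑ tᵢ = 1`,
with the subset diffeology of the product diffeology. -/
abbrev PreJoin (X : ℕ → Type u) : Type u :=
  {p : (ℕ → Set.Icc (0 : ℝ) 1) × (∀ i, X i) //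
    {i | (p.1 i : ℝ) ≠ 0}.Finite ∧ ∑ᶠ i, (p.1 i : ℝ) = 1}

/-- `(tᵢ, xᵢ)` and `(t'ᵢ, x'ᵢ)` are identified if `tᵢ = t'ᵢ` for all `i` and `xᵢ = x'ᵢ` whenever
`tᵢ ≠ 0`. -/
def joinSetoid (X : ℕ → Type u) : Setoid (PreJoin X) where
  r p q := (∀ i, p.1.1 i = q.1.1 i) ∧ ∀ i, (p.1.1 i : ℝ) ≠ 0 → p.1.2 i = q.1.2 i
  iseqv :=
    { refl := fun _ => ⟨fun _ => rfl, fun _ _ => rfl⟩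
      symm := fun h => ⟨fun i => (h.1 i).symm, fun i hi => (h.2 i (by rwa [h.1 i])).symm⟩
      trans := fun h k => ⟨fun i => (h.1 i).trans (k.1 i),
        fun i hi => (h.2 i hi).trans (k.2 i (by rwa [← h.1 i]))⟩ }

/-- The join of a sequence of diffeological spaces. -/
def Join (X : ℕ → Type u) : Type u := Quotient (joinSetoid X)

instance (X : ℕ → Type u) [∀ i, DiffeologicalSpace (X i)] : DiffeologicalSpace (Join X) :=
  inferInstanceAs (DiffeologicalSpace (Quotient (joinSetoid X)))

/-- `EG`, the join of countably many copies of `G`. -/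
abbrev EG (G : Type u) : Type u := Join fun _ : ℕ => G

/-- The action of `G` on `EG`, given by `h • (tᵢ gᵢ) = (tᵢ gᵢ h⁻¹)`. -/
instance EG.instMulAction (G : Type u) [Group G] : MulAction G (EG G) where
  smul h := Quotient.map (fun p => ⟨(p.1.1, fun i => p.1.2 i * h⁻¹), p.2⟩)
    fun _ _ hpq => ⟨hpq.1, fun i hi => congrArg (· * h⁻¹) (hpq.2 i hi)⟩
  one_smul := by
    rintro ⟨p⟩
    refine congrArg (Quotient.mk _) (Subtype.ext (Prod.ext rfl (funext fun i => ?_)))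
    simp
  mul_smul := by
    rintro h k ⟨p⟩
    refine congrArg (Quotient.mk _) (Subtype.ext (Prod.ext rfl (funext fun i => ?_)))
    simp [mul_assoc]

/-- The Milnor classifying space `BG`, the orbit space `EG / G`. -/
def BG (G : Type u) [Group G] : Type u := Quotient (MulAction.orbitRel G (EG G))

instance (G : Type u) [Group G] [DiffeologicalSpace G] : DiffeologicalSpace (BG G) :=
  inferInstanceAs (DiffeologicalSpace (Quotient (MulAction.orbitRel G (EG G))))

end Diffeology

end

/-! Fix `e₀ ∈ EG` over `b`. Let `P` (`LiftPath e₀`) be the space of smooth paths in `EG` that start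
at `e₀` and end in the fibre of `e₀`. It maps to both sides of the isomorphism: projecting a path to
`BG` gives a loop at `b`, and comparing its end point with `e₀` gives an element of `G`, the
holonomy. Both maps induce bijections on all homotopy sets, so `πₖ(BG, b) = πₖ₋₁(Loops b) ≅ πₖ₋₁(P)
≅ πₖ₋₁(G)`. This replaces the long exact sequence of a fibration.

The map `P → Loops b` is a principal fibration whose group consists of the paths in `G` starting at
`1`; that group contracts by shrinking paths. Looping such a fibration gives another one with a
contractible group, so `IsPrincipal.homotopyPi_bijective` follows by induction from the statement on
`π₀`. The lifts come from `IsLocallyPrincipal.exists_lift`: `EG → BG` lifts plots locally and two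
lifts differ by a smooth map to `G`, so local lifts can be patched to a lift over all of `ℝⁿ`.

The map `P → G` is a homotopy equivalence because `EG` is contractible (`EG.contractible`). The join
contracts by moving each weight from index `i + 1` to index `i`, one after another, and then joining
with a fixed point at the free index `0`. Since the number of nonzero weights need not be locally
bounded along a plot, the weights are first squeezed so that it is.

These equivalences do not respect base points up to homotopy. Free homotopies suffice, because on
loop spaces a free homotopy becomes conjugation by the track of the base point, which is invertible
up to free homotopy.

For `k ≥ 2` both bijections are homomorphisms because they are induced by smooth maps. For `k = 1`
the group structure of `π₀(G)` comes from `G`, and holonomy is multiplicative on lifts of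
concatenated loops. -/

noncomputable section

namespace Diffeology

universe u

/-! ### Smoothness of maps between diffeological spaces -/

attribute [fun_prop] dSmooth_fst dSmooth_snd DSmooth.prodMk

section Basic

variable {A X Y Z : Type*} [DiffeologicalSpace A] [DiffeologicalSpace X] [DiffeologicalSpace Y]
  [DiffeologicalSpace Z]

@[fun_prop]
theorem DSmooth.fst {f : A → X × Y} (hf : DSmooth f) : DSmooth fun a => (f a).1 :=
  dSmooth_fst.comp hf

@[fun_prop]
theorem DSmooth.snd {f : A → X × Y} (hf : DSmooth f) : DSmooth fun a => (f a).2 :=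
  dSmooth_snd.comp hf

@[fun_prop]
theorem DSmooth.add {f g : A → ℝ} (hf : DSmooth f) (hg : DSmooth g) :
    DSmooth fun a => f a + g a :=
  (show DSmooth fun q : ℝ × ℝ => q.1 + q.2 from
    (contDiff_fst.add contDiff_snd).dSmooth).comp (hf.prodMk hg)

@[fun_prop]
theorem DSmooth.sub {f g : A → ℝ} (hf : DSmooth f) (hg : DSmooth g) :
    DSmooth fun a => f a - g a :=
  (show DSmooth fun q : ℝ × ℝ => q.1 - q.2 from
    (contDiff_fst.sub contDiff_snd).dSmooth).comp (hf.prodMk hg)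

@[fun_prop]
theorem DSmooth.mul {f g : A → ℝ} (hf : DSmooth f) (hg : DSmooth g) :
    DSmooth fun a => f a * g a :=
  (show DSmooth fun q : ℝ × ℝ => q.1 * q.2 from
    (contDiff_fst.mul contDiff_snd).dSmooth).comp (hf.prodMk hg)

@[fun_prop]
theorem DSmooth.cut {f : A → ℝ} (hf : DSmooth f) : DSmooth fun a => cut (f a) :=
  cut_contDiff.dSmooth.comp hf

@[fun_prop]
theorem DSmooth.smoothTransition {f : A → ℝ} (hf : DSmooth f) :
    DSmooth fun a => Real.smoothTransition (f a) :=
  Real.smoothTransition.contDiff.dSmooth.comp hf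

theorem DSmooth.sum {ι : Type*} {f : ι → A → ℝ} (s : Finset ι) (hf : ∀ i ∈ s, DSmooth (f i)) :
    DSmooth fun a => ∑ i ∈ s, f i a := by
  classical
  induction s using Finset.induction_on with
  | empty => simpa using dSmooth_const
  | insert i s hi ih =>
    simp only [Finset.sum_insert hi]
    exact (hf i (Finset.mem_insert_self _ _)).add
      (ih fun j hj => hf j (Finset.mem_insert_of_mem hj))

theorem DSmooth.subtype_val {P : X → Prop} : DSmooth (Subtype.val : Subtype P → X) :=
  fun _ _ hp => hp

theorem DSmooth.subtype_mk {P : X → Prop} {f : A → X} (hf : DSmooth f) (h : ∀ a, P (f a)) :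
    DSmooth fun a => (⟨f a, h a⟩ : Subtype P) :=
  fun _ _ hp => hf _ _ hp

theorem DSmooth.pi {ι : Type*} {X : ι → Type*} [∀ i, DiffeologicalSpace (X i)]
    {f : A → ∀ i, X i} (hf : ∀ i, DSmooth fun a => f a i) : DSmooth f :=
  fun _ _ hp i => hf i _ _ hp

theorem DSmooth.eval {ι : Type*} {X : ι → Type*} [∀ i, DiffeologicalSpace (X i)]
    {f : A → ∀ i, X i} (hf : DSmooth f) (i : ι) : DSmooth fun a => f a i :=
  fun _ _ hp => hf _ _ hp i

/-- A map is smooth if along every plot it agrees locally with a plot. -/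
theorem dSmooth_of_eventuallyEq {f : X → Y}
    (h : ∀ (n : ℕ) (p : EuclideanSpace ℝ (Fin n) → X), IsPlot p → ∀ r,
      ∃ q : EuclideanSpace ℝ (Fin n) → Y, IsPlot q ∧ ∀ᶠ r' in 𝓝 r, f (p r') = q r') :
    DSmooth f :=
  fun n p hp => isPlot_of_eventuallyEq (h n p hp)

theorem dSmooth_quotient_mk (s : Setoid X) : DSmooth (Quotient.mk s) :=
  fun _ p hp _ => ⟨p, hp, Filter.Eventually.of_forall fun _ => rfl⟩

/-- A map out of a product with a quotient is smooth if its composition with the projection is. -/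
theorem dSmooth_quotient_prod {s : Setoid X} {F : Quotient s × Y → Z}
    (h : DSmooth fun q : X × Y => F (Quotient.mk s q.1, q.2)) : DSmooth F := by
  refine dSmooth_of_eventuallyEq fun n p hp r => ?_
  obtain ⟨q, hq, hpq⟩ := hp.1 r
  refine ⟨_, h _ (fun r => (q r, (p r).2)) ⟨hq, hp.2⟩, ?_⟩
  filter_upwards [hpq] with r' hr'
  exact congrArg F (Prod.ext hr' rfl)

end Basic

/-- Uncurrying a plot of a loop space gives a map on `ℝⁿ × ℝ`; its smooth maps must be the usual
ones for lifts of plots to be available there. -/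
instance {E F : Type*} [NormedAddCommGroup E] [NormedSpace ℝ E] [DiffeologicalSpace E]
    [IsContDiffCompatible E] [NormedAddCommGroup F] [NormedSpace ℝ F] [DiffeologicalSpace F]
    [IsContDiffCompatible F] : IsContDiffCompatible (E × F) where
  isPlot_iff {n p} := by
    rw [contDiff_prod_iff]
    exact and_congr isPlot_iff_contDiff isPlot_iff_contDiff

/-! ### Path spaces -/

/-- The smooth paths `ℝ → X`. -/
structure SmoothPath (X : Type u) [DiffeologicalSpace X] : Type u where
  toFun : ℝ → X
  smooth : DSmooth toFun

/-- The functional diffeology on a path space. -/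
instance (X : Type u) [DiffeologicalSpace X] : DiffeologicalSpace (SmoothPath X) where
  plots n := {P | DSmooth fun q : EuclideanSpace ℝ (Fin n) × ℝ => (P q.1).toFun q.2}
  constant_plots γ := γ.smooth.comp dSmooth_snd
  plot_reparam {n m P f} hP hf := by
    have : DSmooth fun q : EuclideanSpace ℝ (Fin n) × ℝ => (f q.1, q.2) :=
      (hf.dSmooth.comp dSmooth_fst).prodMk dSmooth_snd
    exact DSmooth.comp hP this
  locality {n P} hP := by
    intro m p hp
    refine DiffeologicalSpace.locality fun r => ?_
    have h1 : ContDiff ℝ ∞ fun r => (p r).1 := isPlot_iff_contDiff.1 hp.1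
    obtain ⟨U, hU, hr, h⟩ := hP (p r).1
    refine ⟨(fun r => (p r).1) ⁻¹' U, hU.preimage h1.continuous, hr, fun {k f} hf hfs => ?_⟩
    have h2 : IsPlot fun y => (p (f y)).2 := isPlot_reparam hp.2 hfs
    have h3 : DSmooth fun q : EuclideanSpace ℝ (Fin k) × ℝ => (P (p (f q.1)).1).toFun q.2 :=
      h (f := fun y => (p (f y)).1) hf (h1.comp hfs)
    exact DSmooth.isPlot (h3.comp' (dSmooth_id.prodMk h2.dSmooth))

theorem SmoothPath.dSmooth_iff {X A : Type*} [DiffeologicalSpace X] [DiffeologicalSpace A]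
    {Γ : A → SmoothPath X} :
    DSmooth Γ ↔ DSmooth fun q : A × ℝ => (Γ q.1).toFun q.2 := by
  constructor
  · intro h n p hp
    have h1 : DSmooth fun q : EuclideanSpace ℝ (Fin n) × ℝ => (Γ (p q.1).1).toFun q.2 :=
      h _ _ hp.1
    have h2 : DSmooth fun r => (p r).2 := IsPlot.dSmooth hp.2
    exact DSmooth.isPlot (h1.comp' (dSmooth_id.prodMk h2))
  · intro h n p hp
    exact DSmooth.comp h ((hp.dSmooth.comp dSmooth_fst).prodMk dSmooth_snd)

@[fun_prop]
theorem DSmooth.loop_apply {X A : Type*} [DiffeologicalSpace X] [DiffeologicalSpace A] {x : X}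
    {Γ : A → Loops x} {t : A → ℝ} (hΓ : DSmooth Γ) (ht : DSmooth t) :
    DSmooth fun a => (Γ a).toFun (t a) :=
  (Loops.dSmooth_iff.1 hΓ).comp (dSmooth_id.prodMk ht)

/-! ### Smooth homotopies -/

/-- Two maps are smoothly homotopic if they are the ends of a smooth family of maps. -/
def DHomotopic {X Y : Type*} [DiffeologicalSpace X] [DiffeologicalSpace Y] (f g : X → Y) : Prop :=
  ∃ K : X × ℝ → Y, DSmooth K ∧ (∀ x, K (x, 0) = f x) ∧ ∀ x, K (x, 1) = g x

section Homotopic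

variable {X Y Z : Type*} [DiffeologicalSpace X] [DiffeologicalSpace Y] [DiffeologicalSpace Z]

theorem DHomotopic.symm {f g : X → Y} : DHomotopic f g → DHomotopic g f := by
  rintro ⟨K, hK, h0, h1⟩
  refine ⟨fun q => K (q.1, 1 - q.2), hK.comp (by fun_prop), fun x => ?_, fun x => ?_⟩
  · simp [h1]
  · simp [h0]

theorem DHomotopic.trans {f g h : X → Y} : DHomotopic f g → DHomotopic g h → DHomotopic f h := by
  rintro ⟨K, hK, h0, h1⟩ ⟨L, hL, k0, k1⟩
  have e : ∀ x, K (x, 1) = L (x, 0) := fun x => (h1 x).trans (k0 x).symm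
  refine ⟨fun q => joinPath (fun t => K (q.1, t)) (fun t => L (q.1, t)) (2 * q.2), ?_,
    fun x => ?_, fun x => ?_⟩
  · exact dSmooth_glue (c := fun q : X × ℝ => 2 * q.2) (by fun_prop)
      (a := 2 / 3) (b := 4 / 3) (by norm_num)
      (F₁ := fun q => K (q.1, cut (2 * q.2))) (F₂ := fun q => L (q.1, cut (2 * q.2 - 1)))
      (hK.comp (by fun_prop)) (hL.comp (by fun_prop))
      (fun q hq => joinPath_of_lt (e q.1) hq) (fun q hq => joinPath_of_gt (e q.1) hq)
  · change joinPath _ _ (2 * 0) = _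
    rw [joinPath_of_lt (e x) (by norm_num), cut_eq_zero (by norm_num), h0]
  · change joinPath _ _ (2 * 1) = _
    rw [joinPath_of_gt (e x) (by norm_num), cut_eq_one (by norm_num), k1]

theorem DHomotopic.dSmooth_right {f g : X → Y} (h : DHomotopic f g) : DSmooth g := by
  obtain ⟨K, hK, -, h1⟩ := h
  rw [← funext h1]
  exact hK.comp (by fun_prop)

theorem DHomotopic.comp_right {f g : Y → Z} (h : DHomotopic f g) {k : X → Y} (hk : DSmooth k) :
    DHomotopic (fun x => f (k x)) fun x => g (k x) := by
  obtain ⟨K, hK, h0, h1⟩ := h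
  exact ⟨fun q => K (k q.1, q.2), hK.comp (by fun_prop), fun x => h0 _, fun x => h1 _⟩

theorem DHomotopic.of_eq {f g : X → Y} (hf : DSmooth f) (h : ∀ x, f x = g x) : DHomotopic f g :=
  ⟨fun q => f q.1, hf.comp dSmooth_fst, fun _ => rfl, h⟩

end Homotopic

/-! ### Functoriality of homotopy groups -/

/-- The map of loop spaces induced by a smooth map. -/
def Loops.map {X Y : Type u} [DiffeologicalSpace X] [DiffeologicalSpace Y] {f : X → Y}
    (hf : DSmooth f) {x : X} {y : Y} (h : f x = y) (γ : Loops x) : Loops y where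
  toFun t := f (γ.toFun t)
  smooth := hf.comp γ.smooth
  source := by rw [γ.source, h]
  target := by rw [γ.target, h]

section Map

variable {X Y Z : Type u} [DiffeologicalSpace X] [DiffeologicalSpace Y] [DiffeologicalSpace Z]

theorem Loops.dSmooth_map {f : X → Y} (hf : DSmooth f) {x : X} {y : Y} (h : f x = y) :
    DSmooth (Loops.map hf h) :=
  Loops.dSmooth_iff.2 (hf.comp (Loops.dSmooth_iff.1 dSmooth_id))

theorem Loops.map_const {f : X → Y} (hf : DSmooth f) {x : X} {y : Y} (h : f x = y) :
    Loops.map hf h (Loops.const x) = Loops.const y := by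
  ext t; exact h

theorem Loops.map_concat {f : X → Y} (hf : DSmooth f) {x : X} {y : Y} (h : f x = y)
    (α β : Loops x) :
    Loops.map hf h (α.concat β) = (Loops.map hf h α).concat (Loops.map hf h β) := by
  ext t
  change f (joinPath _ _ _) = joinPath _ _ _
  unfold joinPath
  split_ifs <;> rfl

end Map

/-- The map of homotopy sets induced by a smooth map. -/
def HomotopyPi.map : (n : ℕ) → {X Y : Type u} → [DiffeologicalSpace X] → [DiffeologicalSpace Y] →
    {f : X → Y} → DSmooth f → {x : X} → {y : Y} → f x = y → HomotopyPi n x → HomotopyPi n y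
  | 0, _, _, _, _, f, hf, _, _, _ => Quotient.map f fun _ _ h => h.map hf
  | n + 1, _, _, _, _, _, hf, _, _, h =>
    HomotopyPi.map n (Loops.dSmooth_map hf h) (Loops.map_const hf h)

theorem HomotopyPi.map_mul (n : ℕ) {X Y : Type u} [DiffeologicalSpace X] [DiffeologicalSpace Y]
    {f : X → Y} (hf : DSmooth f) {x : X} {y : Y} (h : f x = y) (a b : HomotopyPi (n + 1) x) :
    HomotopyPi.map (n + 1) hf h (a * b) =
      HomotopyPi.map (n + 1) hf h a * HomotopyPi.map (n + 1) hf h b := by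
  induction n generalizing X Y with
  | zero =>
    induction a using Quotient.inductionOn with | _ a
    induction b using Quotient.inductionOn with | _ b
    exact congrArg (Quotient.mk _) (Loops.map_concat hf h a b)
  | succ n ih => exact ih (Loops.dSmooth_map hf h) (Loops.map_const hf h) a b

/-- The hypothesis is pointwise rather than `f = id`, so that it passes to `Loops.map` in the
induction. -/
theorem HomotopyPi.map_id (n : ℕ) {X : Type u} [DiffeologicalSpace X] {f : X → X} (hf : DSmooth f)
    (hid : ∀ x, f x = x) {x : X} (h : f x = x) (a : HomotopyPi n x) :
    HomotopyPi.map n hf h a = a := by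
  induction n generalizing X with
  | zero =>
    induction a using Quotient.inductionOn with | _ a
    exact congrArg (Quotient.mk _) (hid a)
  | succ n ih =>
    exact ih (Loops.dSmooth_map hf h) (fun γ => Loops.ext (funext fun t => hid _)) _ a

theorem HomotopyPi.map_comp (n : ℕ) {X Y Z : Type u} [DiffeologicalSpace X] [DiffeologicalSpace Y]
    [DiffeologicalSpace Z] {f : X → Y} (hf : DSmooth f) {g : Y → Z} (hg : DSmooth g) {k : X → Z}
    (hk : DSmooth k) (hgf : ∀ x, g (f x) = k x) {x : X} {y : Y} {z : Z} (h : f x = y)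
    (h' : g y = z) (h'' : k x = z) (a : HomotopyPi n x) :
    HomotopyPi.map n hg h' (HomotopyPi.map n hf h a) = HomotopyPi.map n hk h'' a := by
  induction n generalizing X Y Z with
  | zero =>
    induction a using Quotient.inductionOn with | _ a
    exact congrArg (Quotient.mk _) (hgf a)
  | succ n ih =>
    exact ih (Loops.dSmooth_map hf h) (Loops.dSmooth_map hg h') (Loops.dSmooth_map hk h'')
      (fun γ => Loops.ext (funext fun t => hgf _)) _ _ _ a

/-! ### Homotopy invariance of homotopy groups -/

/-- A bump function, equal to `0` at `0` and `1` and to `1` on `[1/3, 2/3]`. -/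
def plateau (t : ℝ) : ℝ := cut (2 * t) - cut (2 * t - 1)

/-- A cut-off function, equal to `0` on `(-∞, 5/12]` and to `1` on `[7/12, ∞)`. -/
def midCut (t : ℝ) : ℝ := cut (2 * t - 1 / 2)

theorem plateau_zero : plateau 0 = 0 := by
  rw [plateau, cut_eq_zero (by norm_num), cut_eq_zero (by norm_num), sub_zero]

theorem plateau_one : plateau 1 = 0 := by
  rw [plateau, cut_eq_one (by norm_num), cut_eq_one (by norm_num), sub_self]

theorem plateau_eq_one {t : ℝ} (h : (t - 1 / 2) ^ 2 < 1 / 36) : plateau t = 1 := by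
  obtain ⟨h1, h2⟩ := abs_lt_of_sq_lt_sq' (a := t - 1 / 2) (b := (1 / 6 : ℝ))
    (by linarith) (by norm_num)
  rw [plateau, cut_eq_one (by linarith), cut_eq_zero (by linarith), sub_zero]

theorem midCut_zero : midCut 0 = 0 := cut_eq_zero (by norm_num)

theorem midCut_one : midCut 1 = 1 := cut_eq_one (by norm_num)

theorem midCut_eq {t : ℝ} (h : 1 / 144 < (t - 1 / 2) ^ 2) : midCut t = 0 ∨ midCut t = 1 := by
  rcases lt_abs.1 (lt_of_pow_lt_pow_left₀ 2 (abs_nonneg (t - 1 / 2))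
    (a := (1 / 12 : ℝ)) (by rw [sq_abs]; linarith)) with h | h
  · exact Or.inr (cut_eq_one (by linarith))
  · exact Or.inl (cut_eq_zero (by linarith))

theorem Loops.apply_midCut {X : Type*} [DiffeologicalSpace X] {x : X} (γ : Loops x) {t : ℝ}
    (h : 1 / 144 < (t - 1 / 2) ^ 2) : γ.toFun (midCut t) = x := by
  rcases midCut_eq h with h | h <;> rw [h]
  · exact γ.source
  · exact γ.target

@[fun_prop]
theorem DSmooth.plateau {A : Type*} [DiffeologicalSpace A] {f : A → ℝ} (hf : DSmooth f) :
    DSmooth fun a => plateau (f a) :=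
  by unfold Diffeology.plateau; fun_prop

@[fun_prop]
theorem DSmooth.midCut {A : Type*} [DiffeologicalSpace A] {f : A → ℝ} (hf : DSmooth f) :
    DSmooth fun a => midCut (f a) := by
  unfold Diffeology.midCut; fun_prop

theorem DSmooth.pow_two {A : Type*} [DiffeologicalSpace A] {f : A → ℝ} (hf : DSmooth f) :
    DSmooth fun a => f a ^ 2 := by
  simpa only [sq] using hf.mul hf

/-- Gluing along the middle of the interval. -/
theorem dSmooth_glue_mid {A Y : Type*} [DiffeologicalSpace A] [DiffeologicalSpace Y] {c : A → ℝ}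
    (hc : DSmooth c) {F₁ F₂ : A → Y} (h₁ : DSmooth F₁) (h₂ : DSmooth F₂)
    (h : ∀ a, (c a - 1 / 2) ^ 2 < 1 / 36 → 1 / 144 < (c a - 1 / 2) ^ 2 → F₁ a = F₂ a) :
    DSmooth fun a => if (c a - 1 / 2) ^ 2 < 1 / 64 then F₁ a else F₂ a := by
  -- The two formulas agree where `1/12 < |c - 1/2| < 1/6`, and the switch at distance `1/8` lies in
  -- between. Squares replace absolute values to keep the gluing function smooth.
  refine dSmooth_glue (c := fun a => (c a - 1 / 2) ^ 2) (DSmooth.pow_two (by fun_prop))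
    (a := 1 / 144) (b := 1 / 36) (by norm_num) h₁ h₂ (fun a ha => ?_) (fun a ha => ?_)
  · split_ifs with h'
    · rfl
    · exact (h a ha (by linarith [not_lt.1 h'])).symm
  · split_ifs with h'
    · exact h a (by linarith) ha
    · rfl

/-! ### Conjugation of loops along a path. -/

section Conj

variable {Y : Type u} [DiffeologicalSpace Y] {σ : ℝ → Y} {y y' : Y}

/-- The conjugate of a loop at `σ 1` by the path `σ`. -/
def Loops.conj (hσ : DSmooth σ) (h0 : σ 0 = y) (h1 : σ 1 = y') (δ : Loops y') : Loops y where
  -- The plateau runs out along `σ`, waits at `σ 1` during `[1/3, 2/3]` and runs back; `midCut`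
  -- traverses `δ` within the waiting time.
  toFun t := if (t - 1 / 2) ^ 2 < 1 / 64 then δ.toFun (midCut t) else σ (plateau t)
  smooth := by
    refine dSmooth_glue_mid (c := fun t => t) (by fun_prop) (δ.smooth.comp (by fun_prop))
      (hσ.comp (by fun_prop)) fun t ht ht' => ?_
    rw [δ.apply_midCut ht', plateau_eq_one ht, h1]
  source := by rw [if_neg (by norm_num), plateau_zero, h0]
  target := by rw [if_neg (by norm_num), plateau_one, h0]

theorem Loops.dSmooth_conj (hσ : DSmooth σ) (h0 : σ 0 = y) (h1 : σ 1 = y') :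
    DSmooth (Loops.conj hσ h0 h1) := by
  refine Loops.dSmooth_iff.2 (dSmooth_glue_mid (c := fun q : Loops y' × ℝ => q.2) (by fun_prop)
    (F₁ := fun q => q.1.toFun (midCut q.2)) (F₂ := fun q => σ (plateau q.2)) (by fun_prop)
    (hσ.comp (by fun_prop)) fun q hq hq' => ?_)
  rw [q.1.apply_midCut hq', plateau_eq_one hq, h1]

/-- Precomposition of a loop with a self-map of `ℝ` that fixes `0` and `1`. -/
def Loops.reparam {w : ℝ → ℝ} (hw : DSmooth w) (h0 : w 0 = 0) (h1 : w 1 = 1) (δ : Loops y) :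
    Loops y :=
  ⟨fun t => δ.toFun (w t), δ.smooth.comp hw, by rw [h0, δ.source], by rw [h1, δ.target]⟩

theorem Loops.reparam_homotopic {w : ℝ → ℝ} (hw : DSmooth w) (h0 : w 0 = 0) (h1 : w 1 = 1) :
    DHomotopic (fun δ : Loops y => δ) (Loops.reparam hw h0 h1) := by
  have hM : DSmooth fun q : (Loops y × ℝ) × ℝ =>
      q.1.1.toFun ((1 - q.1.2) * q.2 + q.1.2 * w q.2) := by fun_prop
  refine ⟨fun q => ⟨fun t => q.1.toFun ((1 - q.2) * t + q.2 * w t),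
    hM.comp (dSmooth_const.prodMk dSmooth_id), ?_, ?_⟩, Loops.dSmooth_iff.2 hM, fun δ => ?_,
    fun δ => ?_⟩
  · rw [h0, mul_zero, mul_zero, add_zero, q.1.source]
  · rw [h1, mul_one, mul_one, sub_add_cancel, q.1.target]
  · ext t; simp
  · ext t; simp [Loops.reparam]

theorem midCut_midCut_zero : midCut (midCut 0) = 0 := by rw [midCut_zero, midCut_zero]

theorem midCut_midCut_one : midCut (midCut 1) = 1 := by rw [midCut_one, midCut_one]

/-- The position along `σ` in the twofold conjugate by `σ` and by its reverse. -/
def retrace (t : ℝ) : ℝ := plateau (midCut t) + (1 - plateau t)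

@[fun_prop]
theorem DSmooth.retrace {A : Type*} [DiffeologicalSpace A] {f : A → ℝ} (hf : DSmooth f) :
    DSmooth fun a => retrace (f a) := by
  unfold Diffeology.retrace; fun_prop

/-- If `midCut t` is close to `1/2`, it is neither `0` nor `1`, which forces `t` itself to be close
to `1/2`; so both plateaus have value `1`. -/
theorem retrace_eq_one {t : ℝ} (ht : (midCut t - 1 / 2) ^ 2 < 1 / 36) : retrace t = 1 := by
  have : plateau t = 1 := by
    refine plateau_eq_one (lt_of_not_ge fun h => ?_)
    rcases midCut_eq (t := t) (by linarith) with h | h <;> rw [h] at ht <;> norm_num at ht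
  rw [retrace, this, plateau_eq_one ht, sub_self, add_zero]

theorem retrace_zero : retrace 0 = 1 := by
  rw [retrace, midCut_zero, plateau_zero]; norm_num

theorem retrace_one : retrace 1 = 1 := by
  rw [retrace, midCut_one, plateau_one]; norm_num

/-- The twofold conjugate runs back along `σ`, forward along `σ`, through `δ`, and returns in the
same way. The excursion along `σ` can be retracted to its end `σ 1`, which leaves `δ` reparametrized
by `midCut ∘ midCut`. -/
theorem Loops.reparam_homotopic_conj_conj (hσ : DSmooth σ) (h0 : σ 0 = y) (h1 : σ 1 = y')
    {τ : ℝ → Y} (hτ : DSmooth τ) (h0' : τ 0 = y') (h1' : τ 1 = y) (hτσ : ∀ t, τ t = σ (1 - t))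
    (hm : DSmooth fun t => midCut (midCut t)) :
    DHomotopic (Loops.reparam hm midCut_midCut_zero midCut_midCut_one)
      fun δ : Loops y' => (Loops.conj hσ h0 h1 δ).conj hτ h0' h1' := by
  -- One formula, `retrace`, covers both excursions: on the inner part `1 - plateau t` vanishes and
  -- on the outer part `plateau (midCut t)` vanishes. The parameter `q.2` moves the position along
  -- `σ` from the constant `1` to `retrace t`.
  let M : Loops y' × ℝ → ℝ → Y := fun q t => if (midCut t - 1 / 2) ^ 2 < 1 / 64 then
    q.1.toFun (midCut (midCut t)) else σ ((1 - q.2) + q.2 * retrace t)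
  have hM : DSmooth fun q : (Loops y' × ℝ) × ℝ => M q.1 q.2 := by
    refine dSmooth_glue_mid (c := fun q : (Loops y' × ℝ) × ℝ => midCut q.2) (by fun_prop)
      (F₁ := fun q => q.1.1.toFun (midCut (midCut q.2)))
      (F₂ := fun q => σ ((1 - q.1.2) + q.1.2 * retrace q.2)) (by fun_prop)
      (hσ.comp (by fun_prop)) fun q hq hq' => ?_
    rw [q.1.1.apply_midCut hq', retrace_eq_one hq, mul_one, sub_add_cancel, h1]
  have hMs : ∀ q, DSmooth (M q) := fun q =>
    hM.comp' (f := fun t : ℝ => (q, t)) (dSmooth_const.prodMk dSmooth_id')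
  refine ⟨fun q => ⟨M q, hMs q, ?_, ?_⟩,
    Loops.dSmooth_iff.2 hM, fun δ => ?_, fun δ => ?_⟩
  · simp only [M]
    rw [if_neg (by rw [midCut_zero]; norm_num), retrace_zero, mul_one, sub_add_cancel, h1]
  · simp only [M]
    rw [if_neg (by rw [midCut_one]; norm_num), retrace_one, mul_one, sub_add_cancel, h1]
  · ext t
    simp only [M, Loops.reparam]
    split_ifs with h
    · rfl
    · rw [δ.apply_midCut (by linarith [not_lt.1 h]), zero_mul, sub_zero, add_zero, h1]
  · ext t
    simp only [M, Loops.conj]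
    by_cases ht : (t - 1 / 2) ^ 2 < 1 / 64
    · have : retrace t = plateau (midCut t) := by
        rw [retrace, plateau_eq_one (t := t) (by linarith), sub_self, add_zero]
      rw [if_pos ht, this, sub_self, zero_add, one_mul]
    · have h := midCut_eq (t := t) (by linarith [not_lt.1 ht])
      have hp : plateau (midCut t) = 0 := by
        rcases h with h | h <;> rw [h]
        · exact plateau_zero
        · exact plateau_one
      rw [if_neg ht, if_neg (by rcases h with h | h <;> rw [h] <;> norm_num), hτσ, retrace, hp,
        sub_self, zero_add, one_mul, zero_add]

/-- This homotopy is free: the conjugate of a constant loop need not be constant, so the base point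
of the loop space moves. -/
theorem Loops.conj_conj_homotopic (hσ : DSmooth σ) (h0 : σ 0 = y) (h1 : σ 1 = y')
    {τ : ℝ → Y} (hτ : DSmooth τ) (h0' : τ 0 = y') (h1' : τ 1 = y) (hτσ : ∀ t, τ t = σ (1 - t)) :
    DHomotopic (fun δ => δ) fun δ : Loops y' => (Loops.conj hσ h0 h1 δ).conj hτ h0' h1' :=
  have hm : DSmooth fun t => midCut (midCut t) := by fun_prop
  (Loops.reparam_homotopic hm midCut_midCut_zero midCut_midCut_one).trans
    (Loops.reparam_homotopic_conj_conj hσ h0 h1 hτ h0' h1' hτσ hm)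

end Conj

/-- A free homotopy from `f₀` to `f₁` induces one between the maps of loop spaces, up to
conjugation by the trace of the base point. -/
theorem Loops.conj_map_homotopic {X Y : Type u} [DiffeologicalSpace X] [DiffeologicalSpace Y]
    {f₀ f₁ : X → Y} (hf₀ : DSmooth f₀) (hf₁ : DSmooth f₁) {K : X × ℝ → Y} (hK : DSmooth K)
    (k0 : ∀ x, K (x, 0) = f₀ x) (k1 : ∀ x, K (x, 1) = f₁ x) {x : X} {y₀ y₁ : Y} (h₀ : f₀ x = y₀)
    (h₁ : f₁ x = y₁) (hσ : DSmooth fun t => K (x, t)) (e0 : K (x, 0) = y₀) (e1 : K (x, 1) = y₁) :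
    DHomotopic (Loops.map hf₀ h₀) fun γ => (Loops.map hf₁ h₁ γ).conj hσ e0 e1 := by
  -- The homotopy time is `s * plateau t`, which vanishes at both ends of the loop, so the loops
  -- stay at `y₀`. At `s = 1` the outer part follows the track of the base point while the middle
  -- carries `f₁ ∘ γ`.
  have hM : DSmooth fun q : (Loops x × ℝ) × ℝ =>
      K (q.1.1.toFun ((1 - q.1.2) * q.2 + q.1.2 * midCut q.2), q.1.2 * plateau q.2) :=
    hK.comp (by fun_prop)
  refine ⟨fun q => ⟨fun t => K (q.1.toFun ((1 - q.2) * t + q.2 * midCut t), q.2 * plateau t),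
    hM.comp (dSmooth_const.prodMk dSmooth_id), ?_, ?_⟩, Loops.dSmooth_iff.2 hM, fun γ => ?_,
    fun γ => ?_⟩
  · rw [midCut_zero, plateau_zero, mul_zero, mul_zero, add_zero, q.1.source, e0]
  · rw [midCut_one, plateau_one, mul_one, mul_one, sub_add_cancel, q.1.target, mul_zero, e0]
  · ext t
    simp [k0, Loops.map]
  · ext t
    simp only [Loops.conj, Loops.map]
    split_ifs with h
    · rw [plateau_eq_one (by linarith)]
      simp [k1]
    · simp [γ.apply_midCut (t := t) (by linarith [not_lt.1 h])]

theorem HomotopyPi.map_injective_of_comp (n : ℕ) {X Y Z : Type u} [DiffeologicalSpace X]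
    [DiffeologicalSpace Y] [DiffeologicalSpace Z] {f : X → Y} (hf : DSmooth f) {g : Y → Z}
    (hg : DSmooth g) {k : X → Z} (hk : DSmooth k) (hgf : ∀ x, g (f x) = k x) {x : X} {y : Y}
    {z : Z} (h : f x = y) (h' : k x = z) (hinj : Function.Injective (HomotopyPi.map n hk h')) :
    Function.Injective (HomotopyPi.map n hf h) := by
  intro a b hab
  have hz : g y = z := by rw [← h, hgf, h']
  refine hinj ?_
  rw [← HomotopyPi.map_comp n hf hg hk hgf h hz h', hab,
    HomotopyPi.map_comp n hf hg hk hgf h hz h']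

/-- The induction runs over all spaces at once. Passing to loops turns the homotopy into a free
homotopy from the loop map of `f₀` to the loop map of `f₁` followed by conjugation along the track
of `x`. By induction this composite is injective, hence so is its first factor. -/
theorem HomotopyPi.map_injective_of_homotopic (n : ℕ) {X Y : Type u} [DiffeologicalSpace X]
    [DiffeologicalSpace Y] {f₀ f₁ : X → Y} (hf₀ : DSmooth f₀) (hf₁ : DSmooth f₁)
    (H : DHomotopic f₀ f₁) {x : X} {y₀ y₁ : Y} (h₀ : f₀ x = y₀) (h₁ : f₁ x = y₁)
    (h : Function.Injective (HomotopyPi.map n hf₀ h₀)) :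
    Function.Injective (HomotopyPi.map n hf₁ h₁) := by
  induction n generalizing X Y with
  | zero =>
    obtain ⟨K, hK, k0, k1⟩ := H
    have key : ∀ a : PiZero X, HomotopyPi.map 0 hf₀ h₀ a = HomotopyPi.map 0 hf₁ h₁ a := by
      intro a
      induction a using Quotient.inductionOn with | _ a
      exact Quotient.sound ⟨fun t => K (a, t), hK.comp (by fun_prop), k0 a, k1 a⟩
    intro a b hab
    exact h ((key a).trans (hab.trans (key b).symm))
  | succ n ih =>
    obtain ⟨K, hK, k0, k1⟩ := H
    have hσ : DSmooth fun t => K (x, t) := hK.comp (by fun_prop)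
    have e0 : K (x, 0) = y₀ := (k0 x).trans h₀
    have e1 : K (x, 1) = y₁ := (k1 x).trans h₁
    have h' := ih (Loops.dSmooth_map hf₀ h₀)
      ((Loops.dSmooth_conj hσ e0 e1).comp (Loops.dSmooth_map hf₁ h₁))
      (Loops.conj_map_homotopic hf₀ hf₁ hK k0 k1 h₀ h₁ hσ e0 e1) (Loops.map_const hf₀ h₀) rfl h
    exact HomotopyPi.map_injective_of_comp n (Loops.dSmooth_map hf₁ h₁)
      (Loops.dSmooth_conj hσ e0 e1) _ (fun _ => rfl) (Loops.map_const hf₁ h₁) rfl h'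

theorem HomotopyPi.map_injective_of_homotopic_id (n : ℕ) {X : Type u} [DiffeologicalSpace X]
    {f : X → X} (hf : DSmooth f) (H : DHomotopic (fun x => x) f) {x y : X} (h : f x = y) :
    Function.Injective (HomotopyPi.map n hf h) :=
  HomotopyPi.map_injective_of_homotopic n dSmooth_id' hf H rfl h fun a b hab => by
    rwa [HomotopyPi.map_id n dSmooth_id' (fun _ => rfl),
      HomotopyPi.map_id n dSmooth_id' (fun _ => rfl)] at hab

/-- Conjugation by the reversed path is a left inverse up to free homotopy. -/
theorem HomotopyPi.map_conj_injective (n : ℕ) {Y : Type u} [DiffeologicalSpace Y] {σ : ℝ → Y}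
    {y y' : Y} (hσ : DSmooth σ) (h0 : σ 0 = y) (h1 : σ 1 = y') {δ : Loops y'} {δ' : Loops y}
    (h : Loops.conj hσ h0 h1 δ = δ') :
    Function.Injective (HomotopyPi.map n (Loops.dSmooth_conj hσ h0 h1) h) := by
  have hτ : DSmooth fun t => σ (1 - t) := hσ.comp (by fun_prop)
  have hc := Loops.dSmooth_conj hτ (y := y') (y' := y) (by simpa using h1) (by simpa using h0)
  exact HomotopyPi.map_injective_of_comp n (Loops.dSmooth_conj hσ h0 h1) hc
    (hc.comp (Loops.dSmooth_conj hσ h0 h1)) (fun _ => rfl) h rfl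
    (HomotopyPi.map_injective_of_homotopic_id n _
      (Loops.conj_conj_homotopic hσ h0 h1 hτ _ _ fun _ => rfl) rfl)

/-- As for injectivity, the conjugation composed with the loop map of `f₁` is surjective by
induction; cancelling the conjugation requires its injectivity. -/
theorem HomotopyPi.map_surjective_of_homotopic (n : ℕ) {X Y : Type u} [DiffeologicalSpace X]
    [DiffeologicalSpace Y] {f₀ f₁ : X → Y} (hf₀ : DSmooth f₀) (hf₁ : DSmooth f₁)
    (H : DHomotopic f₀ f₁) {x : X} {y₀ y₁ : Y} (h₀ : f₀ x = y₀) (h₁ : f₁ x = y₁)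
    (h : Function.Surjective (HomotopyPi.map n hf₀ h₀)) :
    Function.Surjective (HomotopyPi.map n hf₁ h₁) := by
  induction n generalizing X Y with
  | zero =>
    obtain ⟨K, hK, k0, k1⟩ := H
    have key : ∀ a : PiZero X, HomotopyPi.map 0 hf₀ h₀ a = HomotopyPi.map 0 hf₁ h₁ a := by
      intro a
      induction a using Quotient.inductionOn with | _ a
      exact Quotient.sound ⟨fun t => K (a, t), hK.comp (by fun_prop), k0 a, k1 a⟩
    intro b
    obtain ⟨a, ha⟩ := h b
    exact ⟨a, (key a).symm.trans ha⟩
  | succ n ih =>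
    obtain ⟨K, hK, k0, k1⟩ := H
    have hσ : DSmooth fun t => K (x, t) := hK.comp (by fun_prop)
    have e0 : K (x, 0) = y₀ := (k0 x).trans h₀
    have e1 : K (x, 1) = y₁ := (k1 x).trans h₁
    have hc := Loops.dSmooth_conj hσ e0 e1
    have h' := ih (Loops.dSmooth_map hf₀ h₀) (hc.comp (Loops.dSmooth_map hf₁ h₁))
      (Loops.conj_map_homotopic hf₀ hf₁ hK k0 k1 h₀ h₁ hσ e0 e1) (Loops.map_const hf₀ h₀) rfl h
    intro b
    -- The base point in the target is the conjugate of the constant loop, not the constant loop at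
    -- `y₀`.
    have hb : Loops.conj hσ e0 e1 (Loops.const y₁) =
      (Loops.conj hσ e0 e1 ∘ Loops.map hf₁ h₁) (Loops.const x) := by
        rw [← Loops.map_const hf₁ h₁]; rfl
    obtain ⟨a, ha⟩ := h' (HomotopyPi.map n hc hb b)
    refine ⟨a, HomotopyPi.map_conj_injective n hσ e0 e1 hb ?_⟩
    rw [← ha]
    exact HomotopyPi.map_comp n (Loops.dSmooth_map hf₁ h₁) hc _ (fun _ => rfl)
      (Loops.map_const hf₁ h₁) hb rfl a

/-- Smooth homotopy equivalences (not assumed to preserve base points up to homotopy) induce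
bijections of homotopy sets. -/
theorem HomotopyPi.map_bijective_of_homotopyEquiv (n : ℕ) {X Y : Type u} [DiffeologicalSpace X]
    [DiffeologicalSpace Y] {f : X → Y} (hf : DSmooth f) {g : Y → X} (hg : DSmooth g)
    (hgf : DHomotopic (fun x => x) fun x => g (f x))
    (hfg : DHomotopic (fun y => y) fun y => f (g y)) {x : X} {y : Y} (h : f x = y) :
    Function.Bijective (HomotopyPi.map n hf h) := by
  have hgf' : DSmooth fun x => g (f x) := hg.comp hf
  have hfg' : DSmooth fun y => f (g y) := hf.comp hg
  refine ⟨HomotopyPi.map_injective_of_comp n hf hg hgf' (fun _ => rfl) h rfl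
    (HomotopyPi.map_injective_of_homotopic_id n hgf' hgf rfl), fun b => ?_⟩
  have hsurj : Function.Surjective (HomotopyPi.map n hgf' (x := x) rfl) :=
    HomotopyPi.map_surjective_of_homotopic n dSmooth_id' hgf' hgf rfl rfl fun a =>
      ⟨a, HomotopyPi.map_id n dSmooth_id' (fun _ => rfl) rfl a⟩
  -- Surjectivity of `f` follows from surjectivity of `g ∘ f` together with injectivity of `g`; the
  -- latter is tested at `y`, through `f ∘ g`.
  have hinj : Function.Injective (HomotopyPi.map n hg (x := y) (y := g (f x)) (by rw [h])) :=
    HomotopyPi.map_injective_of_comp n hg hf hfg' (fun _ => rfl) _ rfl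
      (HomotopyPi.map_injective_of_homotopic_id n hfg' hfg rfl)
  obtain ⟨a, ha⟩ := hsurj (HomotopyPi.map n hg (by rw [h]) b)
  refine ⟨a, hinj ?_⟩
  rw [← ha]
  exact HomotopyPi.map_comp n hf hg hgf' (fun _ => rfl) h _ rfl a

/-! ### Principal fibrations -/

/-- `f : X → Y` is a principal fibration with structure group `K`: the group acts smoothly and
freely on the fibres, plots of `Y` lift to `X`, and two lifts differ by a plot of `K`. -/
structure IsPrincipal (K : Type u) {X Y : Type u} [Group K] [DiffeologicalSpace K]
    [DiffeologicalSpace X] [DiffeologicalSpace Y] [MulAction K X] (f : X → Y) : Prop where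
  smooth_smul : DSmooth fun q : K × X => q.1 • q.2
  smooth : DSmooth f
  map_smul : ∀ (k : K) (x : X), f (k • x) = f x
  free : ∀ (k : K) (x : X), k • x = x → k = 1
  lift : ∀ (n : ℕ) (p : EuclideanSpace ℝ (Fin n) → Y), IsPlot p →
    ∃ q : EuclideanSpace ℝ (Fin n) → X, IsPlot q ∧ ∀ r, f (q r) = p r
  div : ∀ (n : ℕ) (q q' : EuclideanSpace ℝ (Fin n) → X), IsPlot q → IsPlot q' →
    (∀ r, f (q r) = f (q' r)) →
    ∃ α : EuclideanSpace ℝ (Fin n) → K, IsPlot α ∧ ∀ r, q' r = α r • q r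

/-- A diffeological group that contracts smoothly to its neutral element, which is fixed. -/
def PointedContractible (K : Type u) [Group K] [DiffeologicalSpace K] : Prop :=
  ∃ c : K × ℝ → K, DSmooth c ∧ (∀ k, c (k, 0) = 1) ∧ (∀ k, c (k, 1) = k) ∧ ∀ s, c (1, s) = 1

section Principal

variable {K X Y : Type u} [Group K] [DiffeologicalSpace K] [DiffeologicalSpace X]
  [DiffeologicalSpace Y] [MulAction K X] {f : X → Y}

theorem IsPrincipal.lift_of_normed (hf : IsPrincipal K f) {E : Type*} [NormedAddCommGroup E]
    [NormedSpace ℝ E] [FiniteDimensional ℝ E] [DiffeologicalSpace E] [IsContDiffCompatible E]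
    {p : E → Y} (hp : DSmooth p) : ∃ q : E → X, DSmooth q ∧ ∀ r, f (q r) = p r := by
  let e := toEuclidean (E := E)
  obtain ⟨q, hq, h⟩ := hf.lift _ _ (hp _ _ e.symm.contDiff.isPlot)
  exact ⟨q ∘ e, hq.dSmooth.comp e.contDiff.dSmooth, fun r => by simp [h]⟩

theorem IsPrincipal.div_of_normed (hf : IsPrincipal K f) {E : Type*} [NormedAddCommGroup E]
    [NormedSpace ℝ E] [FiniteDimensional ℝ E] [DiffeologicalSpace E] [IsContDiffCompatible E]
    {q q' : E → X} (hq : DSmooth q) (hq' : DSmooth q') (h : ∀ r, f (q r) = f (q' r)) :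
    ∃ α : E → K, DSmooth α ∧ ∀ r, q' r = α r • q r := by
  let e := toEuclidean (E := E)
  obtain ⟨α, hα, h'⟩ := hf.div _ _ _ (hq _ _ e.symm.contDiff.isPlot)
    (hq' _ _ e.symm.contDiff.isPlot) fun r => h _
  exact ⟨α ∘ e, hα.dSmooth.comp e.contDiff.dSmooth, fun r => by simpa using h' (e r)⟩

theorem IsPrincipal.exists_smul (hf : IsPrincipal K f) {x x' : X} (h : f x = f x') :
    ∃ k : K, x' = k • x := by
  obtain ⟨α, -, hα⟩ := hf.div 0 (fun _ => x) (fun _ => x') isPlot_const isPlot_const fun _ => h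
  exact ⟨α 0, hα 0⟩

theorem PointedContractible.connected (hK : PointedContractible K) (k : K) :
    SmoothlyConnected 1 k := by
  obtain ⟨c, hc, c0, c1, -⟩ := hK
  exact ⟨fun t => c (k, t), hc.comp (by fun_prop), c0 k, c1 k⟩

theorem IsPrincipal.piZero_bijective (hf : IsPrincipal K f) (hK : PointedContractible K) {x : X}
    {y : Y} (h : f x = y) : Function.Bijective (HomotopyPi.map 0 hf.smooth h) := by
  refine ⟨fun a b hab => ?_, fun b => ?_⟩
  · induction a using Quotient.inductionOn with | _ a
    induction b using Quotient.inductionOn with | _ b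
    obtain ⟨γ, hγ, h0, h1⟩ : SmoothlyConnected (f a) (f b) := Quotient.exact hab
    obtain ⟨q, hq, hqγ⟩ := hf.lift_of_normed hγ
    -- Fibres are orbits of the connected group `K`, so each lies in a single path component.
    have key : ∀ (x x' : X), f x = f x' → SmoothlyConnected x x' := fun x x' hx => by
      obtain ⟨k, rfl⟩ := hf.exists_smul hx
      have hs : DSmooth fun k : K => k • x :=
        hf.smooth_smul.comp (dSmooth_id.prodMk dSmooth_const)
      simpa using (hK.connected k).map hs
    refine Quotient.sound ?_
    have := smoothlyConnected_equivalence X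
    exact this.trans (key a (q 0) (by rw [hqγ, h0]))
      (this.trans ⟨q, hq, rfl, rfl⟩ (key (q 1) b (by rw [hqγ, h1])))
  · induction b using Quotient.inductionOn with | _ b
    obtain ⟨q, -, hq⟩ := hf.lift 0 (fun _ => b) isPlot_const
    exact ⟨Quotient.mk _ (q 0), congrArg (Quotient.mk _) (hq 0)⟩

end Principal

/-! ### Loop spaces of principal fibrations. -/

section LoopGroup

variable {K : Type u} [Group K] [DiffeologicalSpace K] [DiffeologicalGroup K]

theorem DSmooth.group_mul {A : Type*} [DiffeologicalSpace A] {f g : A → K} (hf : DSmooth f)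
    (hg : DSmooth g) : DSmooth fun a => f a * g a :=
  DiffeologicalGroup.smooth_mul.comp (hf.prodMk hg)

theorem DSmooth.group_inv {A : Type*} [DiffeologicalSpace A] {f : A → K} (hf : DSmooth f) :
    DSmooth fun a => (f a)⁻¹ :=
  DiffeologicalGroup.smooth_inv.comp hf

variable (K) in
/-- The pointwise group structure on the loops at the neutral element of a group. -/
@[reducible]
def Loops.pointwiseGroup : Group (Loops (1 : K)) where
  mul α β := ⟨fun t => α.toFun t * β.toFun t, α.smooth.group_mul β.smooth,
    by rw [α.source, β.source, one_mul], by rw [α.target, β.target, one_mul]⟩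
  one := Loops.const 1
  inv α := ⟨fun t => (α.toFun t)⁻¹, α.smooth.group_inv, by rw [α.source, inv_one],
    by rw [α.target, inv_one]⟩
  mul_assoc α β γ := Loops.ext (funext fun _ => mul_assoc _ _ _)
  one_mul α := Loops.ext (funext fun _ => one_mul _)
  mul_one α := Loops.ext (funext fun _ => mul_one _)
  inv_mul_cancel α := Loops.ext (funext fun _ => inv_mul_cancel _)

attribute [local instance] Loops.pointwiseGroup

theorem Loops.diffeologicalGroup : DiffeologicalGroup (Loops (1 : K)) where
  smooth_mul := Loops.dSmooth_iff.2
    (DSmooth.group_mul (f := fun q : (Loops (1 : K) × Loops (1 : K)) × ℝ => q.1.1.toFun q.2)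
      (g := fun q => q.1.2.toFun q.2) (by fun_prop) (by fun_prop))
  smooth_inv := Loops.dSmooth_iff.2
    (DSmooth.group_inv (f := fun q : Loops (1 : K) × ℝ => q.1.toFun q.2) (by fun_prop))

/-- Contracting pointwise keeps loops based at `1` because the contraction fixes `1`. -/
theorem PointedContractible.loops (hK : PointedContractible K) :
    PointedContractible (Loops (1 : K)) := by
  obtain ⟨c, hc, c0, c1, c2⟩ := hK
  have h : DSmooth fun q : (Loops (1 : K) × ℝ) × ℝ => c (q.1.1.toFun q.2, q.1.2) :=
    hc.comp (by fun_prop)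
  refine ⟨fun q => ⟨fun t => c (q.1.toFun t, q.2), hc.comp' ?_, ?_, ?_⟩,
    Loops.dSmooth_iff.2 h, fun k => ?_, fun k => ?_, fun s => ?_⟩
  · exact q.1.smooth.prodMk dSmooth_const
  · rw [q.1.source, c2]
  · rw [q.1.target, c2]
  · exact Loops.ext (funext fun t => c0 _)
  · exact Loops.ext (funext fun t => c1 _)
  · exact Loops.ext (funext fun t => c2 _)

variable {X Y : Type u} [DiffeologicalSpace X] [DiffeologicalSpace Y] [MulAction K X] {f : X → Y}

/-- The pointwise action of loops in a group on loops in a space. -/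
@[reducible]
def Loops.pointwiseAction (hf : DSmooth fun q : K × X => q.1 • q.2) (x : X) :
    MulAction (Loops (1 : K)) (Loops x) where
  smul α γ := ⟨fun t => α.toFun t • γ.toFun t, hf.comp' (α.smooth.prodMk γ.smooth),
    by rw [α.source, γ.source, one_smul], by rw [α.target, γ.target, one_smul]⟩
  one_smul γ := Loops.ext (funext fun _ => one_smul _ _)
  mul_smul α β γ := Loops.ext (funext fun _ => mul_smul _ _ _)

/-- A lift of the uncurried plot has its ends in the fibre of `x`, but not at `x`. The smooth
families in `K` that correct the ends extend over the whole time interval because `K` is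
contractible. -/
theorem IsPrincipal.loops_lift (hf : IsPrincipal K f) (hK : PointedContractible K) {x : X} {y : Y}
    (h : f x = y) (n : ℕ) (p : EuclideanSpace ℝ (Fin n) → Loops y) (hp : IsPlot p) :
    ∃ q : EuclideanSpace ℝ (Fin n) → Loops x, IsPlot q ∧
      ∀ r, Loops.map hf.smooth h (q r) = p r := by
  obtain ⟨c, hc, c0, c1, c2⟩ := hK
  obtain ⟨q, hq, hqp⟩ := hf.lift_of_normed (Loops.dSmooth_iff.1 hp.dSmooth)
  have hend : ∀ t : ℝ, (∀ r, (p r).toFun t = y) →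
      ∃ α : EuclideanSpace ℝ (Fin n) → K, DSmooth α ∧ ∀ r, x = α r • q (r, t) := fun t ht =>
    hf.div_of_normed (q := fun r => q (r, t)) (hq.comp (by fun_prop)) dSmooth_const
      fun r => by rw [hqp, ht, h]
  obtain ⟨α, hα, hα'⟩ := hend 0 fun r => (p r).source
  obtain ⟨β, hβ, hβ'⟩ := hend 1 fun r => (p r).target
  -- The factor is `α` at time `0` and `β` at time `1`: one correction is contracted to `1` while
  -- the other grows from `1`.
  let F : EuclideanSpace ℝ (Fin n) × ℝ → X := fun q' =>
    (c (α q'.1, 1 - cut q'.2) * c (β q'.1, cut q'.2)) • q q'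
  have hF : DSmooth F := hf.smooth_smul.comp ((DSmooth.group_mul
    (hc.comp ((hα.comp dSmooth_fst).prodMk (by fun_prop)))
    (hc.comp ((hβ.comp dSmooth_fst).prodMk (by fun_prop)))).prodMk hq)
  refine ⟨fun r => ⟨fun t => F (r, t), hF.comp (by fun_prop), ?_, ?_⟩, ?_, fun r => ?_⟩
  · simp only [F]
    rw [cut_eq_zero (by norm_num), sub_zero, c1, c0, mul_one, ← hα']
  · simp only [F]
    rw [cut_eq_one (by norm_num), sub_self, c1, c0, one_mul, ← hβ']
  · exact DSmooth.isPlot (Loops.dSmooth_iff.2 hF)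
  · ext t
    exact (hf.map_smul _ _).trans (hqp (r, t))

/-- This is the inductive step for `IsPrincipal.homotopyPi_bijective`. The quotient of two lifted
loops is a path in `K` whose ends fix `x`; freeness makes it a loop at `1`. -/
theorem IsPrincipal.loops (hf : IsPrincipal K f) (hK : PointedContractible K) {x : X} {y : Y}
    (h : f x = y) :
    letI := Loops.pointwiseAction hf.smooth_smul x
    IsPrincipal (Loops (1 : K)) (Loops.map hf.smooth h) := by
  let := Loops.pointwiseAction hf.smooth_smul x
  have hsmul : ∀ (α : Loops (1 : K)) (γ : Loops x) (t : ℝ),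
    (α • γ).toFun t = α.toFun t • γ.toFun t := fun _ _ _ => rfl
  refine ⟨?_, Loops.dSmooth_map _ _, fun α γ => ?_, fun α γ hαγ => ?_, hf.loops_lift hK h,
    fun n q q' hq hq' hqq' => ?_⟩
  · exact Loops.dSmooth_iff.2 (hf.smooth_smul.comp'
      (f := fun q : (Loops (1 : K) × Loops x) × ℝ => (q.1.1.toFun q.2, q.1.2.toFun q.2))
      (by fun_prop))
  · exact Loops.ext (funext fun t => hf.map_smul _ _)
  · exact Loops.ext (funext fun t => hf.free _ _ (by rw [← hsmul, hαγ]))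
  · obtain ⟨α, hα, hα'⟩ := hf.div_of_normed (Loops.dSmooth_iff.1 hq.dSmooth)
      (Loops.dSmooth_iff.1 hq'.dSmooth) fun r => congrFun (congrArg Loops.toFun (hqq' r.1)) r.2
    refine ⟨fun r => ⟨fun t => α (r, t), hα.comp (by fun_prop), ?_, ?_⟩,
      DSmooth.isPlot (Loops.dSmooth_iff.2 hα), fun r => Loops.ext (funext fun t => hα' (r, t))⟩
    · have := hα' (r, 0)
      rw [(q r).source, (q' r).source] at this
      exact hf.free _ _ this.symm
    · have := hα' (r, 1)
      rw [(q r).target, (q' r).target] at this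
      exact hf.free _ _ this.symm

/-- A principal fibration with contractible structure group induces bijections of homotopy
sets. -/
theorem IsPrincipal.homotopyPi_bijective (n : ℕ) {K X Y : Type u} [Group K] [DiffeologicalSpace K]
    [DiffeologicalGroup K] [DiffeologicalSpace X] [DiffeologicalSpace Y] [MulAction K X]
    {f : X → Y} (hf : IsPrincipal K f) (hK : PointedContractible K) {x : X} {y : Y} (h : f x = y) :
    Function.Bijective (HomotopyPi.map n hf.smooth h) := by
  induction n generalizing K X Y with
  | zero => exact hf.piZero_bijective hK h
  | succ n ih =>
    let := Loops.pointwiseAction hf.smooth_smul x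
    have := Loops.diffeologicalGroup (K := K)
    exact ih (hf.loops hK h) hK.loops (Loops.map_const hf.smooth h)

end LoopGroup

/-! ### The bundle `EG → BG` -/

/-- The class of a sequence in the join. -/
def Join.mk {X : ℕ → Type u} (x : PreJoin X) : Join X := Quotient.mk (joinSetoid X) x

theorem Join.mk_eq_iff {X : ℕ → Type u} {x y : PreJoin X} : Join.mk x = Join.mk y ↔
    (∀ i, x.1.1 i = y.1.1 i) ∧ ∀ i, (x.1.1 i : ℝ) ≠ 0 → x.1.2 i = y.1.2 i :=
  Quotient.eq (r := joinSetoid X)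

theorem Join.dSmooth_mk {X : ℕ → Type u} [∀ i, DiffeologicalSpace (X i)] :
    DSmooth (Join.mk (X := X)) := dSmooth_quotient_mk (joinSetoid X)

theorem PreJoin.dSmooth_weight {X : ℕ → Type u} [∀ i, DiffeologicalSpace (X i)] (i : ℕ) :
    DSmooth fun x : PreJoin X => (x.1.1 i : ℝ) :=
  DSmooth.subtype_val.comp (DSmooth.eval (dSmooth_fst.comp DSmooth.subtype_val) i)

theorem PreJoin.dSmooth_point {X : ℕ → Type u} [∀ i, DiffeologicalSpace (X i)] (i : ℕ) :
    DSmooth fun x : PreJoin X => x.1.2 i :=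
  DSmooth.eval (dSmooth_snd.comp DSmooth.subtype_val) i

section Bundle

variable {G : Type u} [Group G]

theorem PreJoin.exists_ne_zero {X : ℕ → Type u} (x : PreJoin X) : ∃ i, (x.1.1 i : ℝ) ≠ 0 := by
  by_contra! h
  have := x.2.2
  simp [h] at this

/-- The projection `EG → BG`. -/
def EG.proj (e : EG G) : BG G := Quotient.mk (MulAction.orbitRel G (EG G)) e

theorem EG.proj_eq_iff {e e' : EG G} : EG.proj e = EG.proj e' ↔ ∃ h : G, h • e' = e :=
  Quotient.eq (r := MulAction.orbitRel G (EG G))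

theorem EG.proj_smul (h : G) (e : EG G) : EG.proj (h • e) = EG.proj e :=
  EG.proj_eq_iff.2 ⟨h, rfl⟩

theorem EG.smul_mk (h : G) (x : PreJoin fun _ => G) :
    h • (Join.mk x : EG G) = Join.mk ⟨(x.1.1, fun i => x.1.2 i * h⁻¹), x.2⟩ := rfl

/-- A single coordinate of nonzero weight determines the group element. This gives freeness of the
action and a smooth local formula for the quotient of two points of a fibre. -/
theorem EG.eq_inv_mul_of_smul_eq {h : G} {x y : PreJoin fun _ => G}
    (e : h • (Join.mk x : EG G) = Join.mk y) {i : ℕ} (hi : (x.1.1 i : ℝ) ≠ 0) :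
    h = (y.1.2 i)⁻¹ * x.1.2 i := by
  rw [EG.smul_mk, Join.mk_eq_iff] at e
  rw [← e.2 i hi]
  group

theorem EG.eq_one_of_smul_eq {h : G} {e : EG G} (he : h • e = e) : h = 1 := by
  obtain ⟨x, rfl⟩ : ∃ x, Join.mk x = e := Quotient.exists_rep e
  obtain ⟨i, hi⟩ := x.exists_ne_zero
  rw [EG.eq_inv_mul_of_smul_eq he hi, inv_mul_cancel]

variable [DiffeologicalSpace G]

theorem EG.dSmooth_proj : DSmooth (EG.proj (G := G)) :=
  dSmooth_quotient_mk (MulAction.orbitRel G (EG G))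

theorem EG.exists_local_lift {n : ℕ} {p : EuclideanSpace ℝ (Fin n) → BG G} (hp : IsPlot p)
    (r : EuclideanSpace ℝ (Fin n)) :
    ∃ q : EuclideanSpace ℝ (Fin n) → EG G, IsPlot q ∧ ∀ᶠ r' in 𝓝 r, EG.proj (q r') = p r' := by
  obtain ⟨q, hq, h⟩ := hp r
  exact ⟨q, hq, h.mono fun _ h => h.symm⟩

variable [DiffeologicalGroup G]

theorem EG.dSmooth_smul : DSmooth fun q : G × EG G => q.1 • q.2 := by
  -- The factors are swapped because `dSmooth_quotient_prod` expects the quotient on the left.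
  have h : DSmooth fun q : EG G × G => q.2 • q.1 := by
    refine dSmooth_quotient_prod (s := joinSetoid fun _ => G) (X := PreJoin fun _ => G)
      (Y := G) ?_
    refine Join.dSmooth_mk.comp' (f := fun q : PreJoin (fun _ => G) × G =>
      (⟨(q.1.1.1, fun i => q.1.1.2 i * q.2⁻¹), q.1.2⟩ : PreJoin fun _ => G)) ?_
    refine DSmooth.subtype_mk (DSmooth.prodMk ?_ (DSmooth.pi (X := fun _ => G) fun i => ?_)) _
    · exact dSmooth_fst.comp (DSmooth.subtype_val.comp dSmooth_fst)
    · exact DSmooth.group_mul ((PreJoin.dSmooth_point i).comp dSmooth_fst)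
        (DSmooth.group_inv dSmooth_snd)
  exact h.comp (dSmooth_snd.prodMk dSmooth_fst)

theorem EG.exists_plot_smul {n : ℕ} {q q' : EuclideanSpace ℝ (Fin n) → EG G} (hq : IsPlot q)
    (hq' : IsPlot q') (h : ∀ r, EG.proj (q r) = EG.proj (q' r)) :
    ∃ α : EuclideanSpace ℝ (Fin n) → G, IsPlot α ∧ ∀ r, q' r = α r • q r := by
  choose α hα using fun r => EG.proj_eq_iff.1 (h r).symm
  refine ⟨α, isPlot_of_eventuallyEq fun r => ?_, fun r => (hα r).symm⟩
  obtain ⟨x, hx, hqx⟩ := hq r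
  obtain ⟨y, hy, hqy⟩ := hq' r
  -- The weight at this index stays nonzero near `r`, so the same coordinate computes `α` on a
  -- neighbourhood.
  obtain ⟨i, hi⟩ := (x r).exists_ne_zero
  have hc : Continuous fun r => ((x r).1.1 i : ℝ) :=
    (((PreJoin.dSmooth_weight i).comp hx.dSmooth).isPlot.contDiff).continuous
  refine ⟨fun r => ((y r).1.2 i)⁻¹ * (x r).1.2 i, ?_, ?_⟩
  · exact DSmooth.isPlot (DSmooth.group_mul
      (DSmooth.group_inv ((PreJoin.dSmooth_point i).comp hy.dSmooth))
      ((PreJoin.dSmooth_point i).comp hx.dSmooth))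
  · filter_upwards [hqx, hqy, hc.continuousAt.eventually_ne hi] with r' h1 h2 h3
    refine EG.eq_inv_mul_of_smul_eq ?_ h3
    have := hα r'
    rw [h1, h2] at this
    exact this

end Bundle

/-! ### Triviality of locally trivial bundles over `ℝⁿ` -/

/-- Plots are defined on all of `ℝⁿ`. Precomposition with a clamp turns identities valid only on a
box into global ones, without changing anything on a smaller box. -/
theorem exists_smooth_clamp {a a' b' b : ℝ} (ha : a < a') (h : a' ≤ b') (hb : b' < b) :
    ∃ c : ℝ → ℝ, ContDiff ℝ ∞ c ∧ (∀ x, a < c x ∧ c x < b) ∧ ∀ x, a' ≤ x → x ≤ b' → c x = x := by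
  let m : ℝ := (a' + b') / 2
  let δ : ℝ := min (a' - a) (b - b')
  have hδ : 0 < δ := lt_min (by linarith) (by linarith)
  have hδa : δ ≤ a' - a := min_le_left _ _
  have hδb : δ ≤ b - b' := min_le_right _ _
  -- The bump is `1` on `[a', b']` and vanishes beyond distance `(b' - a') / 2 + δ` from the
  -- midpoint, so the displacement from `m` stays below that radius; `δ` fits into both margins.
  let φ : ContDiffBump m := ⟨(b' - a') / 2 + δ / 2, (b' - a') / 2 + δ, by linarith, by linarith⟩
  refine ⟨fun x => m + φ x * (x - m), contDiff_const.add
    (φ.contDiff.mul (contDiff_id.sub contDiff_const)), fun x => ?_, fun x h1 h2 => ?_⟩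
  · have key : |φ x * (x - m)| < (b' - a') / 2 + δ := by
      rw [abs_mul, abs_of_nonneg φ.nonneg]
      by_cases hx : dist x m < (b' - a') / 2 + δ
      · rw [Real.dist_eq] at hx
        exact (mul_le_of_le_one_left (abs_nonneg _) φ.le_one).trans_lt hx
      · rw [φ.zero_of_le_dist (not_lt.1 hx), zero_mul]
        linarith
    obtain ⟨h1, h2⟩ := abs_lt.1 key
    simp only [m] at *
    constructor <;> linarith
  · have : φ x = 1 := φ.one_of_mem_closedBall (by
      rw [Metric.mem_closedBall, Real.dist_eq, abs_le]
      simp only [m, φ]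
      constructor <;> linarith)
    simp [this]

/-- The open box with corners `l` and `u`. -/
def openBox {n : ℕ} (l u : Fin n → ℝ) : Set (EuclideanSpace ℝ (Fin n)) :=
  {x | ∀ i, l i < x i ∧ x i < u i}

theorem openBox_mono {n : ℕ} {l l' u u' : Fin n → ℝ} (hl : ∀ i, l' i ≤ l i)
    (hu : ∀ i, u i ≤ u' i) : openBox l u ⊆ openBox l' u' :=
  fun _ hx i => ⟨(hl i).trans_lt (hx i).1, (hx i).2.trans_le (hu i)⟩

theorem isOpen_openBox {n : ℕ} (l u : Fin n → ℝ) : IsOpen (openBox l u) := by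
  have : openBox l u = ⋂ i, {x | l i < x i ∧ x i < u i} := by ext; simp [openBox]
  rw [this]
  refine isOpen_iInter_of_finite fun i => ?_
  have hi : Continuous fun x : EuclideanSpace ℝ (Fin n) => x i := by fun_prop
  exact (isOpen_lt continuous_const hi).inter (isOpen_lt hi continuous_const)

theorem exists_smooth_clamp_box {n : ℕ} {l l' u' u : Fin n → ℝ} (hl : ∀ i, l i < l' i)
    (h : ∀ i, l' i ≤ u' i) (hu : ∀ i, u' i < u i) :
    ∃ ψ : EuclideanSpace ℝ (Fin n) → EuclideanSpace ℝ (Fin n), ContDiff ℝ ∞ ψ ∧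
      (∀ x, ψ x ∈ openBox l u) ∧ ∀ x ∈ openBox l' u', ψ x = x := by
  choose c hc hc1 hc2 using fun i => exists_smooth_clamp (hl i) (h i) (hu i)
  refine ⟨fun x => WithLp.toLp 2 fun i => c i (x i), ?_, fun x i => hc1 i _, fun x hx => ?_⟩
  · rw [contDiff_euclidean]
    intro i
    exact (hc i).comp (by fun_prop)
  · ext i
    exact hc2 i _ (hx i).1.le (hx i).2.le

/-- Like `IsPrincipal`, but with lifts of plots only required to exist locally. -/
structure IsLocallyPrincipal (K : Type u) {X Y : Type u} [Group K] [DiffeologicalSpace K]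
    [DiffeologicalSpace X] [DiffeologicalSpace Y] [MulAction K X] (f : X → Y) : Prop where
  smooth_smul : DSmooth fun q : K × X => q.1 • q.2
  smooth : DSmooth f
  map_smul : ∀ (k : K) (x : X), f (k • x) = f x
  free : ∀ (k : K) (x : X), k • x = x → k = 1
  lift : ∀ (n : ℕ) (p : EuclideanSpace ℝ (Fin n) → Y), IsPlot p → ∀ r,
    ∃ q : EuclideanSpace ℝ (Fin n) → X, IsPlot q ∧ ∀ᶠ r' in 𝓝 r, f (q r') = p r'
  div : ∀ (n : ℕ) (q q' : EuclideanSpace ℝ (Fin n) → X), IsPlot q → IsPlot q' →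
    (∀ r, f (q r) = f (q' r)) →
    ∃ α : EuclideanSpace ℝ (Fin n) → K, IsPlot α ∧ ∀ r, q' r = α r • q r

/-- The map `p` lifts along `f` over the set `S`. -/
def LiftsOn {X Y : Type*} [DiffeologicalSpace X] (f : X → Y) {n : ℕ}
    (p : EuclideanSpace ℝ (Fin n) → Y) (S : Set (EuclideanSpace ℝ (Fin n))) : Prop :=
  ∃ q : EuclideanSpace ℝ (Fin n) → X, IsPlot q ∧ ∀ r ∈ S, f (q r) = p r

/-- The map `p` lifts along `f` over a neighbourhood of the closed box with corners `l`, `u`. -/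
def LiftsNear {X Y : Type*} [DiffeologicalSpace X] (f : X → Y) {n : ℕ}
    (p : EuclideanSpace ℝ (Fin n) → Y) (l u : Fin n → ℝ) : Prop :=
  ∃ ε > 0, LiftsOn f p (openBox (fun i => l i - ε) fun i => u i + ε)

theorem LiftsOn.mono {X Y : Type*} [DiffeologicalSpace X] {f : X → Y} {n : ℕ}
    {p : EuclideanSpace ℝ (Fin n) → Y} {S T : Set (EuclideanSpace ℝ (Fin n))}
    (h : LiftsOn f p T) (hST : S ⊆ T) :
    LiftsOn f p S :=
  let ⟨q, hq, hqp⟩ := h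
  ⟨q, hq, fun r hr => hqp r (hST hr)⟩

/-! ### Patching lifts over boxes and over `ℝⁿ`. -/

section Lift

variable {K X Y : Type u} [Group K] [DiffeologicalSpace K] [DiffeologicalSpace X]
  [DiffeologicalSpace Y] [MulAction K X] {f : X → Y} {n : ℕ} {p : EuclideanSpace ℝ (Fin n) → Y}

theorem IsLocallyPrincipal.isPlot_smul (hf : IsLocallyPrincipal K f)
    {α : EuclideanSpace ℝ (Fin n) → K} {q : EuclideanSpace ℝ (Fin n) → X} (hα : IsPlot α)
    (hq : IsPlot q) : IsPlot fun r => α r • q r :=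
  hf.smooth_smul _ (fun r => (α r, q r)) ⟨hα, hq⟩

/-- A lift over a larger box can be translated so as to agree with a given lift on a smaller
box. -/
theorem IsLocallyPrincipal.exists_matching (hf : IsLocallyPrincipal K f)
    {q q' : EuclideanSpace ℝ (Fin n) → X} (hq : IsPlot q) (hq' : IsPlot q') {l l' u' u : Fin n → ℝ}
    (hl : ∀ i, l i < l' i) (h : ∀ i, l' i ≤ u' i) (hu : ∀ i, u' i < u i)
    (hqp : ∀ r ∈ openBox l u, f (q r) = p r) (hqp' : ∀ r ∈ openBox l u, f (q' r) = p r) :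
    ∃ α : EuclideanSpace ℝ (Fin n) → K, IsPlot α ∧ ∀ r ∈ openBox l' u', q r = α r • q' r := by
  obtain ⟨ψ, hψ, hψ1, hψ2⟩ := exists_smooth_clamp_box hl h hu
  -- After clamping, the two lifts project to the same map everywhere, so `div` applies and yields
  -- `α` on all of `ℝⁿ`.
  obtain ⟨α, hα, hα'⟩ := hf.div n _ _ (isPlot_reparam hq' hψ) (isPlot_reparam hq hψ)
    fun r => (hqp' _ (hψ1 r)).trans (hqp _ (hψ1 r)).symm
  refine ⟨α, hα, fun r hr => ?_⟩
  have := hα' r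
  rwa [Function.comp_apply, Function.comp_apply, hψ2 r hr] at this

/-- The box is cut by the hyperplane `x k = c`. On a slab around it both lifts exist and differ by a
global plot `α` of `K`; translating the second lift by `α` makes them agree there. -/
theorem IsLocallyPrincipal.liftsNear_glue (hf : IsLocallyPrincipal K f) {l u : Fin n → ℝ}
    (hlu : ∀ i, l i ≤ u i) {k : Fin n} {c : ℝ} (hlc : l k ≤ c) (hcu : c ≤ u k)
    (h₁ : LiftsNear f p l (Function.update u k c))
    (h₂ : LiftsNear f p (Function.update l k c) u) : LiftsNear f p l u := by
  obtain ⟨ε₁, hε₁, h₁⟩ := h₁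
  obtain ⟨ε₂, hε₂, h₂⟩ := h₂
  obtain ⟨ε, hε, hεε₁, hεε₂⟩ : ∃ ε > 0, ε ≤ ε₁ ∧ ε ≤ ε₂ :=
    ⟨min ε₁ ε₂, lt_min hε₁ hε₂, min_le_left _ _, min_le_right _ _⟩
  obtain ⟨q₁, hq₁, hqp₁⟩ := h₁.mono (openBox_mono (l := fun i => l i - ε)
    (u := fun i => Function.update u k c i + ε) (by intro i; linarith) (by intro i; linarith))
  obtain ⟨q₂, hq₂, hqp₂⟩ := h₂.mono (openBox_mono (l := fun i => Function.update l k c i - ε)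
    (u := fun i => u i + ε) (by intro i; linarith) (by intro i; linarith))
  have hl' : ∀ i, l i ≤ Function.update l k c i := fun i => by
    by_cases hi : i = k
    · subst hi; simpa using hlc
    · simp [hi]
  have hu' : ∀ i, Function.update u k c i ≤ u i := fun i => by
    by_cases hi : i = k
    · subst hi; simpa using hcu
    · simp [hi]
  have hlu' : ∀ i, Function.update l k c i ≤ Function.update u k c i := fun i => by
    by_cases hi : i = k
    · subst hi; simp
    · simpa [hi] using hlu i
  obtain ⟨α, hα, hαq⟩ := hf.exists_matching (p := p) hq₁ hq₂
    (l := fun i => Function.update l k c i - ε) (u := fun i => Function.update u k c i + ε)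
    (l' := fun i => Function.update l k c i - ε / 2)
    (u' := fun i => Function.update u k c i + ε / 2)
    (fun i => by linarith) (fun i => by linarith [hlu' i]) (fun i => by linarith)
    (fun r hr => hqp₁ r (openBox_mono (fun i => by linarith [hl' i]) (fun i => le_rfl) hr))
    (fun r hr => hqp₂ r (openBox_mono (fun i => le_rfl) (fun i => by linarith [hu' i]) hr))
  -- With values in the margin `ε / 2`, a clamped point whose `k`-th coordinate is within `ε / 2` of
  -- `c` lies in the matching region. The clamp is the identity on the margin `ε / 4`, where the
  -- lift is claimed.
  obtain ⟨Ψ, hΨ, hΨ1, hΨ2⟩ := exists_smooth_clamp_box (l := fun i => l i - ε / 2)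
    (u := fun i => u i + ε / 2) (l' := fun i => l i - ε / 4) (u' := fun i => u i + ε / 4)
    (fun i => by linarith) (fun i => by linarith [hlu i]) (fun i => by linarith)
  have hmatch : ∀ x, c - ε / 2 < Ψ x k → Ψ x k < c + ε / 2 →
      q₁ (Ψ x) = α (Ψ x) • q₂ (Ψ x) := fun x h1 h2 => by
    refine hαq _ fun i => ?_
    by_cases hi : i = k
    · subst hi; simpa using ⟨h1, h2⟩
    · simpa [hi] using hΨ1 x i
  refine ⟨ε / 4, by linarith, fun x => if Ψ x k < c then q₁ (Ψ x) else α (Ψ x) • q₂ (Ψ x), ?_, ?_⟩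
  · have hk : ContDiff ℝ ∞ fun x : EuclideanSpace ℝ (Fin n) => x k := by fun_prop
    refine DSmooth.isPlot (dSmooth_glue (c := fun x => Ψ x k) (hk.comp hΨ).dSmooth
      (a := c - ε / 2) (b := c + ε / 2) (by linarith)
      (isPlot_reparam hq₁ hΨ).dSmooth (isPlot_reparam (hf.isPlot_smul hα hq₂) hΨ).dSmooth
      (fun x hx => ?_) fun x hx => ?_)
    · split_ifs with h
      · rfl
      · exact (hmatch x (by linarith) hx).symm
    · split_ifs with h
      · exact hmatch x hx (by linarith)
      · rfl
  · intro x hx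
    beta_reduce
    rw [hΨ2 x hx]
    split_ifs with h
    · refine hqp₁ x fun i => ⟨by linarith [(hx i).1], ?_⟩
      by_cases hi : i = k
      · subst hi; simp only [Function.update_self]; linarith
      · simp only [Function.update_of_ne hi]; linarith [(hx i).2]
    · rw [hf.map_smul]
      refine hqp₂ x fun i => ⟨?_, by linarith [(hx i).2]⟩
      by_cases hi : i = k
      · subst hi; simp only [Function.update_self]; linarith
      · simp only [Function.update_of_ne hi]; linarith [(hx i).1]

theorem IsLocallyPrincipal.exists_liftsNear_small (hf : IsLocallyPrincipal K f) (hp : IsPlot p)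
    (l u : Fin n → ℝ) : ∃ η > 0, ∀ l' u' : Fin n → ℝ, (∀ i, l i ≤ l' i) → (∀ i, l' i ≤ u i) →
      (∀ i, l' i ≤ u' i) → (∀ i, u' i - l' i ≤ η) → LiftsNear f p l' u' := by
  choose q hq hqp using hf.lift n p hp
  choose U hU hUo hrU using fun r => eventually_nhds_iff.1 (hqp r)
  have hc : Continuous fun x : Fin n → ℝ => (WithLp.toLp 2 x : EuclideanSpace ℝ (Fin n)) :=
    PiLp.continuous_toLp 2 _
  obtain ⟨δ, hδ, h⟩ := lebesgue_number_lemma_of_metric (isCompact_Icc (a := l) (b := u))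
    (c := fun r => (fun x : Fin n → ℝ => (WithLp.toLp 2 x : EuclideanSpace ℝ (Fin n))) ⁻¹' U r)
    (fun r => (hUo r).preimage hc)
    fun x _ => Set.mem_iUnion.2 ⟨WithLp.toLp 2 x, hrU _⟩
  refine ⟨δ / 2, by linarith, fun l' u' hl hu hlu hη => ?_⟩
  obtain ⟨r, hr⟩ := h l' ⟨hl, hu⟩
  -- A box of side at most `δ / 2`, enlarged by `δ / 2`, lies in the sup-norm ball of radius `δ`
  -- about its lower corner.
  refine ⟨δ / 2, by linarith, q r, hq r, fun x hx => hU r x ?_⟩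
  have : x.ofLp ∈ Metric.ball l' δ := by
    rw [Metric.mem_ball, dist_pi_lt_iff hδ]
    intro i
    rw [Real.dist_eq, abs_lt]
    constructor <;> linarith [(hx i).1, (hx i).2, hη i]
  exact hr this

theorem IsLocallyPrincipal.liftsNear (hf : IsLocallyPrincipal K f) (hp : IsPlot p)
    {l u : Fin n → ℝ} (hlu : ∀ i, l i ≤ u i) : LiftsNear f p l u := by
  classical
  obtain ⟨η, hη, hsmall⟩ := hf.exists_liftsNear_small hp l u
  -- `S` is the set of directions in which the box may be longer than `η`.
  have key : ∀ S : Finset (Fin n), ∀ l' u' : Fin n → ℝ, (∀ i, l i ≤ l' i) →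
      (∀ i, u' i ≤ u i) → (∀ i, l' i ≤ u' i) → (∀ i ∉ S, u' i - l' i ≤ η) →
      LiftsNear f p l' u' := by
    intro S
    induction S using Finset.induction_on with
    | empty =>
      exact fun l' u' hl hu hlu hs => hsmall l' u' hl (fun i => (hlu i).trans (hu i)) hlu
        fun i => hs i (Finset.notMem_empty i)
    | insert k S hk ih =>
      -- `N` bounds the number of slabs of width at most `η` into which direction `k` is divided.
      have step : ∀ N : ℕ, ∀ l' u' : Fin n → ℝ, (∀ i, l i ≤ l' i) → (∀ i, u' i ≤ u i) →
          (∀ i, l' i ≤ u' i) → (∀ i ∉ insert k S, u' i - l' i ≤ η) → u' k - l' k ≤ N * η →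
          LiftsNear f p l' u' := by
        intro N
        induction N with
        | zero =>
          intro l' u' hl hu hlu hs hN
          refine ih l' u' hl hu hlu fun i hi => ?_
          by_cases hik : i = k
          · subst hik
            push_cast at hN
            linarith
          · exact hs i (by simp [hik, hi])
        | succ N ihN =>
          intro l' u' hl hu hlu hs hN
          obtain ⟨c, hc1, hc2, hc3, hc4⟩ : ∃ c, l' k ≤ c ∧ c ≤ u' k ∧ c - l' k ≤ η ∧
              u' k - c ≤ N * η := by
            refine ⟨min (u' k) (l' k + η), le_min (hlu k) (by linarith), min_le_left _ _,
              by linarith [min_le_right (u' k) (l' k + η)], ?_⟩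
            push_cast at hN
            rcases min_choice (u' k) (l' k + η) with h | h <;> rw [h]
            · rw [sub_self]; positivity
            · linarith
          refine hf.liftsNear_glue hlu hc1 hc2
            (ih _ _ hl (fun i => ?_) (fun i => ?_) fun i hi => ?_)
            (ihN _ _ (fun i => ?_) hu (fun i => ?_) (fun i hi => ?_) ?_)
          · by_cases hik : i = k
            · subst hik; simpa using hc2.trans (hu i)
            · simpa [hik] using hu i
          · by_cases hik : i = k
            · subst hik; simpa using hc1
            · simpa [hik] using hlu i
          · by_cases hik : i = k
            · subst hik; simpa using hc3
            · simpa [hik] using hs i (by simp [hik, hi])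
          · by_cases hik : i = k
            · subst hik; simpa using (hl i).trans hc1
            · simpa [hik] using hl i
          · by_cases hik : i = k
            · subst hik; simpa using hc2
            · simpa [hik] using hlu i
          · have hik : i ≠ k := fun h => hi (by simp [h])
            simpa [hik] using hs i hi
          · simpa using hc4
      intro l' u' hl hu hlu hs
      obtain ⟨N, hN⟩ := exists_nat_ge ((u' k - l' k) / η)
      exact step N l' u' hl hu hlu hs ((div_le_iff₀ hη).1 hN)
  exact key Finset.univ l u (fun _ => le_rfl) (fun _ => le_rfl) hlu
    fun i hi => absurd (Finset.mem_univ i) hi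

/-- Cubes exhaust `ℝⁿ`. Each new lift is translated to agree with the preceding one on a smaller
cube, so the sequence of lifts is eventually constant near every point. -/
theorem IsLocallyPrincipal.exists_lift (hf : IsLocallyPrincipal K f) (hp : IsPlot p) :
    ∃ q : EuclideanSpace ℝ (Fin n) → X, IsPlot q ∧ ∀ r, f (q r) = p r := by
  let B : ℕ → Set (EuclideanSpace ℝ (Fin n)) := fun N => openBox (fun _ => -(N : ℝ)) fun _ => N
  have hBmono : ∀ {N M : ℕ}, N ≤ M → B N ⊆ B M := fun {N M} h =>
    openBox_mono (fun _ => neg_le_neg (Nat.cast_le.2 h)) fun _ => Nat.cast_le.2 h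
  have hB : ∀ x, ∃ N, x ∈ B N := fun x => by
    obtain ⟨N, hN⟩ := exists_nat_gt ‖x‖
    refine ⟨N, fun i => abs_lt.1 (lt_of_le_of_lt ?_ hN)⟩
    simpa using PiLp.norm_apply_le x i
  have hlift : ∀ N, LiftsOn f p (B N) := fun N => by
    obtain ⟨ε, hε, h⟩ := hf.liftsNear hp (l := fun _ => -(N : ℝ)) (u := fun _ => N)
      fun _ => by linarith [Nat.cast_nonneg (α := ℝ) N]
    exact h.mono (openBox_mono (fun _ => by linarith) fun _ => by linarith)
  -- The lift with number `N` is valid on `B (N + 1)` but is preserved only on `B N`: the clamp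
  -- needs a margin.
  have hnext : ∀ N (q : EuclideanSpace ℝ (Fin n) → X), IsPlot q →
      (∀ r ∈ B (N + 1), f (q r) = p r) → ∃ q' : EuclideanSpace ℝ (Fin n) → X,
      (IsPlot q' ∧ ∀ r ∈ B (N + 1 + 1), f (q' r) = p r) ∧ ∀ r ∈ B N, q' r = q r := by
    intro N q hq hqp
    obtain ⟨q', hq', hqp'⟩ := hlift (N + 1 + 1)
    obtain ⟨α, hα, hαq⟩ := hf.exists_matching hq hq' (p := p) (l := fun _ => -((N + 1 : ℕ) : ℝ))
      (u := fun _ => ((N + 1 : ℕ) : ℝ)) (l' := fun _ => -(N : ℝ)) (u' := fun _ => N)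
      (fun _ => by push_cast; linarith) (fun _ => by linarith [Nat.cast_nonneg (α := ℝ) N])
      (fun _ => by push_cast; linarith) hqp fun r hr => hqp' r (hBmono (Nat.le_succ _) hr)
    exact ⟨fun r => α r • q' r, ⟨hf.isPlot_smul hα hq', fun r hr => by rw [hf.map_smul, hqp' r hr]⟩,
      fun r hr => (hαq r hr).symm⟩
  choose next hnext₁ hnext₂ using hnext
  obtain ⟨q₀, hq₀⟩ := hlift 1
  let R : ∀ N : ℕ, {q : EuclideanSpace ℝ (Fin n) → X //
      IsPlot q ∧ ∀ r ∈ B (N + 1), f (q r) = p r} := fun N =>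
    Nat.rec ⟨q₀, by simpa using hq₀⟩ (fun N q => ⟨next N q.1 q.2.1 q.2.2, hnext₁ N _ _ _⟩) N
  have hR : ∀ N, ∀ r ∈ B N, (R (N + 1)).1 r = (R N).1 r := fun N => hnext₂ N _ _ _
  have hR' : ∀ {N M : ℕ}, N ≤ M → ∀ r ∈ B N, (R M).1 r = (R N).1 r := fun {N M} h r hr => by
    induction M, h using Nat.le_induction with
    | base => rfl
    | succ M h ih => rw [hR M r (hBmono h hr), ih]
  choose N hN using hB
  have hq : ∀ M, ∀ r ∈ B M, (R (N r)).1 r = (R M).1 r := fun M r hr => by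
    rcases le_total (N r) M with h | h
    · exact (hR' h r (hN r)).symm
    · exact hR' h r hr
  refine ⟨fun r => (R (N r)).1 r, isPlot_of_eventuallyEq fun r => ⟨(R (N r)).1, (R (N r)).2.1, ?_⟩,
    fun r => (R (N r)).2.2 r (hBmono (Nat.le_succ _) (hN r))⟩
  filter_upwards [(isOpen_openBox _ _).mem_nhds (hN r)] with r' hr'
  exact hq _ r' hr'

theorem IsLocallyPrincipal.isPrincipal (hf : IsLocallyPrincipal K f) : IsPrincipal K f where
  smooth_smul := hf.smooth_smul
  smooth := hf.smooth
  map_smul := hf.map_smul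
  free := hf.free
  lift _ _ hp := hf.exists_lift hp
  div := hf.div

end Lift

theorem EG.isPrincipal_proj (G : Type u) [Group G] [DiffeologicalSpace G] [DiffeologicalGroup G] :
    IsPrincipal G (EG.proj (G := G)) :=
  IsLocallyPrincipal.isPrincipal
    { smooth_smul := EG.dSmooth_smul
      smooth := EG.dSmooth_proj
      map_smul := EG.proj_smul
      free := fun _ _ => EG.eq_one_of_smul_eq
      lift := fun _ _ hp r => EG.exists_local_lift hp r
      div := fun _ _ _ hq hq' h => EG.exists_plot_smul hq hq' h }

/-! ### Contractibility of `EG` -/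

/-- Sequences of partial sums of finite partitions of `1`. -/
structure IsSteps (σ : ℕ → ℝ) : Prop where
  zero : σ 0 = 0
  mono : Monotone σ
  top : ∃ N, ∀ n, N ≤ n → σ n = 1

theorem IsSteps.nonneg {σ : ℕ → ℝ} (h : IsSteps σ) (n : ℕ) : 0 ≤ σ n :=
  h.zero.symm.le.trans (h.mono (Nat.zero_le n))

theorem IsSteps.le_one {σ : ℕ → ℝ} (h : IsSteps σ) (n : ℕ) : σ n ≤ 1 := by
  obtain ⟨N, hN⟩ := h.top
  exact (h.mono (le_max_left n N)).trans (hN _ (le_max_right n N)).le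

/-- This is the advantage of partial sums over weights: a monotone reparametrization needs no
renormalization, and a zero weight stays zero. -/
theorem IsSteps.comp {σ : ℕ → ℝ} (h : IsSteps σ) {θ : ℝ → ℝ} (hθ : Monotone θ) (h0 : θ 0 = 0)
    (h1 : θ 1 = 1) : IsSteps fun n => θ (σ n) := by
  obtain ⟨N, hN⟩ := h.top
  exact ⟨by rw [h.zero, h0], hθ.comp h.mono, N, fun n hn => by rw [hN n hn, h1]⟩

/-! ### The join described by partial sums. -/

section Join

variable {X : ℕ → Type u}

/-- The element of the join with given partial sums and points. -/
def PreJoin.ofSteps (σ : ℕ → ℝ) (h : IsSteps σ) (g : ∀ i, X i) : PreJoin X :=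
  ⟨(fun i => ⟨σ (i + 1) - σ i, sub_nonneg.2 (h.mono (Nat.le_succ i)),
      by linarith [h.le_one (i + 1), h.nonneg i]⟩, g), by
    obtain ⟨N, hN⟩ := h.top
    have hsub : (Function.support fun i => σ (i + 1) - σ i) ⊆ (Finset.range N : Set ℕ) := by
      intro i hi
      by_contra hiN
      have hiN : N ≤ i := by simpa using hiN
      exact hi (by simp [hN i hiN, hN (i + 1) (by omega)])
    refine ⟨(Finset.range N).finite_toSet.subset hsub, ?_⟩
    change ∑ᶠ i, (σ (i + 1) - σ i) = 1
    rw [finsum_eq_sum_of_support_subset _ hsub, Finset.sum_range_sub, hN N le_rfl, h.zero,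
      sub_zero]⟩

/-- The partial sums of the weights. -/
def PreJoin.partialSum (x : PreJoin X) (n : ℕ) : ℝ := ∑ i ∈ Finset.range n, (x.1.1 i : ℝ)

theorem PreJoin.partialSum_succ (x : PreJoin X) (n : ℕ) :
    x.partialSum (n + 1) - x.partialSum n = x.1.1 n := by
  rw [partialSum, partialSum, Finset.sum_range_succ, add_sub_cancel_left]

theorem PreJoin.isSteps_partialSum (x : PreJoin X) : IsSteps x.partialSum := by
  refine ⟨Finset.sum_range_zero _, monotone_nat_of_le_succ fun n => ?_, ?_⟩
  · have := x.partialSum_succ n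
    linarith [(x.1.1 n).2.1]
  · obtain ⟨N, hN⟩ := x.2.1.bddAbove
    refine ⟨N + 1, fun n hn => ?_⟩
    refine (finsum_eq_sum_of_support_subset _ fun i hi => ?_).symm.trans x.2.2
    have : i ≤ N := hN hi
    simpa using (show i < n by omega)

theorem PreJoin.ofSteps_partialSum (x : PreJoin X) :
    PreJoin.ofSteps x.partialSum x.isSteps_partialSum x.1.2 = x :=
  Subtype.ext (Prod.ext (funext fun i => Subtype.ext (x.partialSum_succ i)) rfl)

theorem Join.mk_ofSteps_eq {σ σ' : ℕ → ℝ} (h : IsSteps σ) (h' : IsSteps σ') {g g' : ∀ i, X i}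
    (hσ : ∀ n, σ n = σ' n) (hg : ∀ i, σ (i + 1) ≠ σ i → g i = g' i) :
    Join.mk (PreJoin.ofSteps σ h g) = Join.mk (PreJoin.ofSteps σ' h' g') := by
  obtain rfl : σ = σ' := funext hσ
  exact Join.mk_eq_iff.2 ⟨fun _ => rfl, fun i hi => hg i fun e => hi (sub_eq_zero.2 e)⟩

theorem PreJoin.partialSum_eq_of_mk_eq {x y : PreJoin X} (h : Join.mk x = Join.mk y) :
    x.partialSum = y.partialSum :=
  funext fun _ => Finset.sum_congr rfl fun i _ => by rw [(Join.mk_eq_iff.1 h).1 i]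

theorem PreJoin.point_eq_of_mk_eq {x y : PreJoin X} (h : Join.mk x = Join.mk y) {i : ℕ}
    (hi : x.partialSum (i + 1) ≠ x.partialSum i) : x.1.2 i = y.1.2 i :=
  (Join.mk_eq_iff.1 h).2 i (by rwa [← x.partialSum_succ, sub_ne_zero])

theorem Join.exists_mk (e : Join X) : ∃ x, Join.mk x = e := Quotient.exists_rep e

variable [∀ i, DiffeologicalSpace (X i)]

theorem PreJoin.dSmooth_ofSteps {A : Type*} [DiffeologicalSpace A] {σ : A → ℕ → ℝ}
    (h : ∀ a, IsSteps (σ a)) {g : A → ∀ i, X i} (hσ : ∀ i, DSmooth fun a => σ a i)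
    (hg : ∀ i, DSmooth fun a => g a i) :
    DSmooth fun a => PreJoin.ofSteps (σ a) (h a) (g a) :=
  DSmooth.subtype_mk (DSmooth.prodMk
    (DSmooth.pi fun i => DSmooth.subtype_mk ((hσ (i + 1)).sub (hσ i)) _) (DSmooth.pi hg)) _

theorem PreJoin.dSmooth_partialSum (n : ℕ) : DSmooth fun x : PreJoin X => x.partialSum n :=
  DSmooth.sum _ fun i _ => PreJoin.dSmooth_weight i

/-- A smooth homotopy between maps out of the join can be defined on representatives. -/
theorem Join.homotopic_of_lift {Z : Type*} [DiffeologicalSpace Z] {F : PreJoin X × ℝ → Z}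
    (hF : DSmooth F) (hr : ∀ x y t, Join.mk x = Join.mk y → F (x, t) = F (y, t))
    {f₀ f₁ : Join X → Z} (h0 : ∀ x, F (x, 0) = f₀ (Join.mk x))
    (h1 : ∀ x, F (x, 1) = f₁ (Join.mk x)) : DHomotopic f₀ f₁ := by
  let K : Join X × ℝ → Z := fun q =>
    Quotient.lift (fun x => F (x, q.2)) (fun x y h => hr x y q.2 (Quotient.sound h)) q.1
  have hK : DSmooth K := dSmooth_quotient_prod (s := joinSetoid X) hF
  refine ⟨K, hK, fun e => ?_, fun e => ?_⟩ <;> obtain ⟨x, rfl⟩ := e.exists_mk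
  · exact h0 x
  · exact h1 x

end Join

/-- A smooth monotone function from `0` to `1`, constant on `[1/3, ∞)`. -/
def squeezeFun (s : ℝ) : ℝ := Real.smoothTransition (3 * s)

theorem squeezeFun_eq_one {s : ℝ} (h : 1 / 3 ≤ s) : squeezeFun s = 1 :=
  Real.smoothTransition.one_of_one_le (by linarith)

theorem squeezeFun_zero : squeezeFun 0 = 0 := by
  rw [squeezeFun, mul_zero, Real.smoothTransition.zero]

theorem squeezeFun_monotone : Monotone squeezeFun := fun a b h =>
  Real.smoothTransition.monotone (by linarith)

theorem IsSteps.squeeze {σ : ℕ → ℝ} (h : IsSteps σ) : IsSteps fun n => squeezeFun (σ n) :=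
  h.comp squeezeFun_monotone squeezeFun_zero (squeezeFun_eq_one (by norm_num))

theorem IsSteps.interp {σ τ : ℕ → ℝ} (h : IsSteps σ) (h' : IsSteps τ) {a : ℝ} (h0 : 0 ≤ a)
    (h1 : a ≤ 1) : IsSteps fun n => (1 - a) * σ n + a * τ n := by
  obtain ⟨N, hN⟩ := h.top
  obtain ⟨M, hM⟩ := h'.top
  refine ⟨by rw [h.zero, h'.zero, mul_zero, mul_zero, add_zero], fun m n hmn => ?_,
    max N M, fun n hn => ?_⟩
  · have h1' : 0 ≤ 1 - a := by linarith
    have := mul_le_mul_of_nonneg_left (h.mono hmn) h1'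
    have := mul_le_mul_of_nonneg_left (h'.mono hmn) h0
    linarith
  · rw [hN n ((le_max_left _ _).trans hn), hM n ((le_max_right _ _).trans hn)]
    ring

/-- The partial sums shifted by one. -/
def shiftSteps (σ : ℕ → ℝ) : ℕ → ℝ
  | 0 => 0
  | n + 1 => σ n

theorem IsSteps.shift {σ : ℕ → ℝ} (h : IsSteps σ) : IsSteps (shiftSteps σ) := by
  refine ⟨rfl, monotone_nat_of_le_succ fun n => ?_, ?_⟩
  · cases n with
    | zero => exact h.nonneg 0
    | succ n => exact h.mono (Nat.le_succ n)
  · obtain ⟨N, hN⟩ := h.top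
    refine ⟨N + 1, fun n hn => ?_⟩
    obtain ⟨m, rfl⟩ : ∃ m, n = m + 1 := ⟨n - 1, by omega⟩
    exact hN m (by omega)

/-- The partial sums of the partition concentrated at `0`. -/
def unitSteps : ℕ → ℝ
  | 0 => 0
  | _ + 1 => 1

theorem isSteps_unitSteps : IsSteps unitSteps := by
  refine ⟨rfl, monotone_nat_of_le_succ fun n => ?_, 1, fun n hn => ?_⟩
  · cases n with
    | zero => exact zero_le_one
    | succ n => exact le_rfl
  · obtain ⟨m, rfl⟩ : ∃ m, n = m + 1 := ⟨n - 1, by omega⟩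
    rfl

/-- The partial sums in which the weights with index above `a` are shifted by one. -/
def spreadSteps (σ : ℕ → ℝ) (a : ℝ) : ℕ → ℝ
  | 0 => 0
  | n + 1 => σ n + cut (a - n) * (σ (n + 1) - σ n)

theorem IsSteps.spread {σ : ℕ → ℝ} (h : IsSteps σ) (a : ℝ) : IsSteps (spreadSteps σ a) := by
  have hlow : ∀ n, σ n ≤ spreadSteps σ a (n + 1) := fun n => by
    have := mul_nonneg (cut_nonneg (a - n)) (sub_nonneg.2 (h.mono (Nat.le_succ n)))
    simp only [spreadSteps]
    linarith
  have hup : ∀ n, spreadSteps σ a (n + 1) ≤ σ (n + 1) := fun n => by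
    have := mul_le_of_le_one_left (sub_nonneg.2 (h.mono (Nat.le_succ n))) (cut_le_one (a - n))
    simp only [spreadSteps]
    linarith
  refine ⟨rfl, monotone_nat_of_le_succ fun n => ?_, ?_⟩
  · cases n with
    | zero => exact (h.nonneg 0).trans (hlow 0)
    | succ n => exact (hup n).trans (hlow (n + 1))
  · obtain ⟨N, hN⟩ := h.top
    refine ⟨N + 1, fun n hn => ?_⟩
    obtain ⟨m, rfl⟩ : ∃ m, n = m + 1 := ⟨n - 1, by omega⟩
    simp only [spreadSteps]
    rw [hN m (by omega), hN (m + 1) (by omega)]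
    ring

/-- The weight at index `j` vanishes while `a` passes `j`: the old weight `j` has been moved up
entirely, and the old weight `j - 1` not at all. During this time the point at index `j` may jump.
-/
theorem spreadSteps_succ_eq {σ : ℕ → ℝ} (h : IsSteps σ) {a : ℝ} {j : ℕ} (h1 : -(1 / 3) ≤ a - j)
    (h2 : a - j ≤ 1 / 3) : spreadSteps σ a (j + 1) = spreadSteps σ a j := by
  cases j with
  | zero => simp only [spreadSteps, cut_eq_zero h2, zero_mul, add_zero, h.zero]
  | succ i =>
    rw [spreadSteps, cut_eq_zero h2, spreadSteps, cut_eq_one (by push_cast at h1; linarith)]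
    ring

/-! ### The homotopies that contract `EG`. -/

section Contraction

variable {G : Type u}

/-- The sequence `g` shifted by one, with a new first entry. -/
def shiftPoints (g₀ : G) (g : ℕ → G) : ℕ → G
  | 0 => g₀
  | n + 1 => g n

/-- The deformation of `EG` that makes the weights locally finite. -/
def EG.squeeze (e : EG G) : EG G :=
  Quotient.lift (s := joinSetoid fun _ => G)
    (fun x => Join.mk (PreJoin.ofSteps _ x.isSteps_partialSum.squeeze x.1.2))
    (fun x y h => by
      have h' : Join.mk x = Join.mk y := Quotient.sound h
      have hs := PreJoin.partialSum_eq_of_mk_eq h'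
      refine Join.mk_ofSteps_eq _ _ (fun n => by rw [hs]) fun i hi => ?_
      exact PreJoin.point_eq_of_mk_eq h' fun e => hi (by rw [e])) e

/-- The shift of `EG` by one index. -/
def EG.shift (g₀ : G) (e : EG G) : EG G :=
  Quotient.lift (s := joinSetoid fun _ => G)
    (fun x => Join.mk (PreJoin.ofSteps _ x.isSteps_partialSum.shift (shiftPoints g₀ x.1.2)))
    (fun x y h => by
      have h' : Join.mk x = Join.mk y := Quotient.sound h
      have hs := PreJoin.partialSum_eq_of_mk_eq h'
      refine Join.mk_ofSteps_eq _ _ (fun n => by rw [hs]) fun i hi => ?_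
      cases i with
      | zero => rfl
      | succ i => exact PreJoin.point_eq_of_mk_eq h' hi) e

theorem EG.squeeze_mk (x : PreJoin fun _ => G) : EG.squeeze (Join.mk x) =
    Join.mk (PreJoin.ofSteps _ x.isSteps_partialSum.squeeze x.1.2) := rfl

theorem EG.shift_mk (g₀ : G) (x : PreJoin fun _ => G) : EG.shift g₀ (Join.mk x) =
    Join.mk (PreJoin.ofSteps _ x.isSteps_partialSum.shift (shiftPoints g₀ x.1.2)) := rfl

theorem PreJoin.partialSum_ofSteps {X : ℕ → Type u} {σ : ℕ → ℝ} (h : IsSteps σ) (g : ∀ i, X i) :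
    (PreJoin.ofSteps σ h g).partialSum = σ := by
  funext n
  change ∑ i ∈ Finset.range n, (σ (i + 1) - σ i) = σ n
  rw [Finset.sum_range_sub, h.zero, sub_zero]

/-- A smooth bound for the indices of the weights that remain after squeezing. -/
def PreJoin.indexBound (x : PreJoin fun _ => G) : ℝ := ∑ᶠ j, (1 - cut (x.partialSum j))

theorem PreJoin.indexBound_eq {x : PreJoin fun _ => G} {N : ℕ} (h : 2 / 3 ≤ x.partialSum N) :
    x.indexBound = ∑ j ∈ Finset.range N, (1 - cut (x.partialSum j)) := by
  refine finsum_eq_sum_of_support_subset _ fun j hj => ?_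
  by_contra hjN
  have hjN : N ≤ j := by simpa using hjN
  exact hj (sub_eq_zero.2 (cut_eq_one (h.trans (x.isSteps_partialSum.mono hjN))).symm)

/-- Every index `j ≤ i` contributes a full `1` to the sum. These are the indices that may carry
weight after squeezing. -/
theorem PreJoin.le_indexBound {x : PreJoin fun _ => G} {i : ℕ} (h : x.partialSum i ≤ 1 / 3) :
    (i : ℝ) + 1 ≤ x.indexBound := by
  obtain ⟨N, hN⟩ := x.isSteps_partialSum.top
  rw [PreJoin.indexBound_eq (N := max N (i + 1)) (by rw [hN _ (le_max_left _ _)]; norm_num)]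
  calc (i : ℝ) + 1 = ∑ j ∈ Finset.range (i + 1), (1 - cut (x.partialSum j)) := by
        rw [Finset.sum_congr rfl fun j hj => by
          rw [cut_eq_zero ((x.isSteps_partialSum.mono
            (Nat.lt_succ_iff.1 (Finset.mem_range.1 hj))).trans h), sub_zero]]
        simp
    _ ≤ _ := Finset.sum_le_sum_of_subset_of_nonneg
        (Finset.range_subset_range.2 (le_max_right _ _))
        fun j _ _ => sub_nonneg.2 (cut_le_one _)

variable [DiffeologicalSpace G]

/-- The nonzero weights need not have locally bounded indices, but a partial sum equal to `1` at `r`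
exceeds `2/3` nearby, and the later terms then vanish. -/
theorem PreJoin.dSmooth_indexBound :
    DSmooth (PreJoin.indexBound : (PreJoin fun _ => G) → ℝ) := by
  refine dSmooth_of_eventuallyEq fun n p hp r => ?_
  obtain ⟨N, hN⟩ := (p r).isSteps_partialSum.top
  have hs : ∀ j, DSmooth fun r => (p r).partialSum j := fun j =>
    (PreJoin.dSmooth_partialSum j).comp hp.dSmooth
  refine ⟨fun r => ∑ j ∈ Finset.range N, (1 - cut ((p r).partialSum j)),
    DSmooth.isPlot (DSmooth.sum _ fun j _ => dSmooth_const.sub (hs j).cut), ?_⟩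
  have hc : Continuous fun r => (p r).partialSum N := (hs N).contDiff.continuous
  filter_upwards [hc.continuousAt.eventually_const_lt
    (show (2 / 3 : ℝ) < (p r).partialSum N by rw [hN N le_rfl]; norm_num)] with r' hr'
  exact PreJoin.indexBound_eq hr'.le

theorem EG.homotopic_squeeze : DHomotopic (fun e : EG G => e) EG.squeeze := by
  -- Homotopy time ranges over all of `ℝ`; `cut` keeps the coefficients of the convex combination in
  -- `[0, 1]`.
  have hst : ∀ q : PreJoin (fun _ => G) × ℝ, IsSteps fun n =>
      (1 - cut q.2) * q.1.partialSum n + cut q.2 * squeezeFun (q.1.partialSum n) := fun q =>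
    q.1.isSteps_partialSum.interp q.1.isSteps_partialSum.squeeze (cut_nonneg _) (cut_le_one _)
  have hS : ∀ i, DSmooth fun q : PreJoin (fun _ => G) × ℝ => q.1.partialSum i := fun i =>
    (PreJoin.dSmooth_partialSum i).comp dSmooth_fst
  refine Join.homotopic_of_lift (F := fun q => Join.mk (PreJoin.ofSteps _ (hst q) q.1.1.2))
    (Join.dSmooth_mk.comp (PreJoin.dSmooth_ofSteps hst (fun i => ?_)
      fun i => (PreJoin.dSmooth_point i).comp dSmooth_fst)) (fun x y t h => ?_) (fun x => ?_)
      fun x => ?_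
  · have := hS i
    unfold squeezeFun
    fun_prop
  · have hs := PreJoin.partialSum_eq_of_mk_eq h
    exact Join.mk_ofSteps_eq _ _ (fun n => by simp only [hs]) fun i hi =>
      PreJoin.point_eq_of_mk_eq h fun e => hi (by simp only [e])
  · refine (Join.mk_ofSteps_eq _ x.isSteps_partialSum (fun n => ?_) fun i _ => rfl).trans
      (congrArg Join.mk x.ofSteps_partialSum)
    simp only [cut_eq_zero (show (0 : ℝ) ≤ 1 / 3 by norm_num)]
    ring
  · rw [EG.squeeze_mk]
    refine Join.mk_ofSteps_eq _ _ (fun n => ?_) fun i _ => rfl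
    simp only [cut_eq_one (show (2 / 3 : ℝ) ≤ 1 by norm_num)]
    ring

theorem EG.homotopic_shift (g₀ : G) :
    DHomotopic (fun _ : EG G => Join.mk (PreJoin.ofSteps _ isSteps_unitSteps fun _ => g₀))
      (EG.shift g₀) := by
  have hst : ∀ q : PreJoin (fun _ => G) × ℝ, IsSteps fun n =>
      (1 - cut q.2) * unitSteps n + cut q.2 * shiftSteps q.1.partialSum n := fun q =>
    isSteps_unitSteps.interp q.1.isSteps_partialSum.shift (cut_nonneg _) (cut_le_one _)
  refine Join.homotopic_of_lift (F := fun q => Join.mk (PreJoin.ofSteps _ (hst q)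
    (shiftPoints g₀ q.1.1.2))) (Join.dSmooth_mk.comp (PreJoin.dSmooth_ofSteps hst (fun i => ?_)
      fun i => ?_)) (fun x y t h => ?_) (fun x => ?_) fun x => ?_
  · have : DSmooth fun q : PreJoin (fun _ => G) × ℝ => shiftSteps q.1.partialSum i := by
      cases i with
      | zero => exact dSmooth_const
      | succ i => exact (PreJoin.dSmooth_partialSum i).comp dSmooth_fst
    fun_prop
  · cases i with
    | zero => exact dSmooth_const
    | succ i => exact (PreJoin.dSmooth_point i).comp dSmooth_fst
  · have hs := PreJoin.partialSum_eq_of_mk_eq h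
    refine Join.mk_ofSteps_eq _ _ (fun n => by simp only [hs]) fun i hi => ?_
    cases i with
    | zero => rfl
    | succ i =>
      refine PreJoin.point_eq_of_mk_eq h fun e => hi ?_
      simp only [shiftSteps, unitSteps, e]
  · refine Join.mk_ofSteps_eq _ _ (fun n => ?_) fun i hi => ?_
    · simp only [cut_eq_zero (show (0 : ℝ) ≤ 1 / 3 by norm_num)]
      ring
    -- At time `0` all weight sits at index `0`, where `shiftPoints` has the entry `g₀`; the other
    -- entries are irrelevant.
    · cases i with
      | zero => rfl
      | succ i =>
        simp only [cut_eq_zero (show (0 : ℝ) ≤ 1 / 3 by norm_num), unitSteps] at hi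
        exact absurd (by ring) hi
  · rw [EG.shift_mk]
    refine Join.mk_ofSteps_eq _ _ (fun n => ?_) fun i _ => rfl
    simp only [cut_eq_one (show (2 / 3 : ℝ) ≤ 1 by norm_num)]
    ring

/-- The family of representatives that interpolates between the shift and the identity. -/
def PreJoin.spread (g₀ : G) (q : PreJoin (fun _ => G) × ℝ) : PreJoin fun _ => G :=
  PreJoin.ofSteps _ (q.1.isSteps_partialSum.squeeze.spread (q.2 * q.1.indexBound))
    fun j => if q.2 * q.1.indexBound < j then shiftPoints g₀ q.1.1.2 j else q.1.1.2 j

/-- The entries depend discontinuously on the comparison of the threshold with `j`. Near `r` the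
comparison can be frozen at its value at `r`: where it changes, the threshold is within `1/3` of `j`
and the weight is zero by `spreadSteps_succ_eq`. -/
theorem EG.dSmooth_mk_spread (g₀ : G) :
    DSmooth fun q => (Join.mk (PreJoin.spread g₀ q) : EG G) := by
  refine dSmooth_of_eventuallyEq fun n p hp r => ?_
  have hp1 : DSmooth fun r => (p r).1 := dSmooth_fst.comp hp.dSmooth
  have hp2 : DSmooth fun r => (p r).2 := dSmooth_snd.comp hp.dSmooth
  have ha : DSmooth fun r => (p r).2 * (p r).1.indexBound :=
    hp2.mul (PreJoin.dSmooth_indexBound.comp hp1)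
  refine ⟨fun r' => Join.mk (PreJoin.ofSteps _
    ((p r').1.isSteps_partialSum.squeeze.spread ((p r').2 * (p r').1.indexBound))
    fun j => if (p r).2 * (p r).1.indexBound < j then shiftPoints g₀ (p r').1.1.2 j
      else (p r').1.1.2 j), ?_, ?_⟩
  · refine DSmooth.isPlot (Join.dSmooth_mk.comp (PreJoin.dSmooth_ofSteps _ (fun i => ?_)
      fun i => ?_))
    · have hS : ∀ i, DSmooth fun r => (p r).1.partialSum i := fun i =>
        (PreJoin.dSmooth_partialSum i).comp hp1
      cases i with
      | zero => exact dSmooth_const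
      | succ i =>
        have h1 := hS i
        have h2 := hS (i + 1)
        simp only [spreadSteps, squeezeFun]
        fun_prop
    · have hP : ∀ i, DSmooth fun r => (p r).1.1.2 i := fun i =>
        (PreJoin.dSmooth_point i).comp hp1
      split_ifs
      · cases i with
        | zero => exact dSmooth_const
        | succ i => exact hP i
      · exact hP i
  · filter_upwards [Metric.continuousAt_iff'.1 ha.contDiff.continuous.continuousAt (1 / 3)
      (by norm_num)] with r' hr'
    rw [Real.dist_eq, abs_lt] at hr'
    refine Join.mk_ofSteps_eq _ _ (fun _ => rfl) fun j hj => ?_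
    by_cases h1 : (p r').2 * (p r').1.indexBound < j <;>
      by_cases h2 : (p r).2 * (p r).1.indexBound < j
    · simp only [if_pos h1, if_pos h2]
    · exact absurd (spreadSteps_succ_eq (p r').1.isSteps_partialSum.squeeze (by linarith)
        (by linarith)) hj
    · exact absurd (spreadSteps_succ_eq (p r').1.isSteps_partialSum.squeeze (by linarith)
        (by linarith)) hj
    · simp only [if_neg h1, if_neg h2]

/-- The threshold `t * indexBound` moves from `0`, where all weights are shifted, to `indexBound`,
beyond every index that carries weight after squeezing, where none is shifted. -/
theorem EG.shift_squeeze_homotopic (g₀ : G) :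
    DHomotopic (fun e : EG G => EG.shift g₀ (EG.squeeze e)) EG.squeeze := by
  refine Join.homotopic_of_lift (EG.dSmooth_mk_spread g₀) (fun x y t h => ?_) (fun x => ?_)
    fun x => ?_
  · have hs := PreJoin.partialSum_eq_of_mk_eq h
    have hb : x.indexBound = y.indexBound := by rw [PreJoin.indexBound, hs, PreJoin.indexBound]
    refine Join.mk_ofSteps_eq _ _ (fun n => by simp only [hs, hb]) fun j hj => ?_
    -- Representatives differ only at points of weight zero, and away from the transition each new
    -- weight receives only the weight of its own point.
    have hpt : ∀ i, x.1.2 i ≠ y.1.2 i →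
        squeezeFun (x.partialSum (i + 1)) = squeezeFun (x.partialSum i) := fun i hi => by
      by_contra hne
      exact hi (PreJoin.point_eq_of_mk_eq h fun e => hne (by rw [e]))
    have hsq := x.isSteps_partialSum.squeeze
    simp only [hb]
    by_contra hne
    refine hj ?_
    split_ifs at hne with h1
    · cases j with
      | zero => exact absurd rfl hne
      | succ i =>
        simp only [hb] at h1 ⊢
        simp only [spreadSteps, hpt i hne]
        rw [cut_eq_zero (by push_cast at h1 ⊢; linarith)]
        ring
    · simp only [hb] at h1 ⊢
      cases j with
      | zero => simp [spreadSteps, hpt 0 hne, hsq.zero]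
      | succ i =>
        simp only [spreadSteps, hpt _ hne]
        rw [cut_eq_one (t := t * y.indexBound - i) (by push_cast at h1; linarith)]
        ring
  · rw [EG.squeeze_mk, EG.shift_mk]
    have e0 : ∀ n : ℕ, cut (0 * x.indexBound - n) = 0 := fun n =>
      cut_eq_zero (by rw [zero_mul]; linarith [Nat.cast_nonneg (α := ℝ) n])
    have hs : ∀ n, spreadSteps (fun n => squeezeFun (x.partialSum n)) (0 * x.indexBound) n =
        shiftSteps (fun n => squeezeFun (x.partialSum n)) n := fun n => by
      cases n with
      | zero => rfl
      | succ n => rw [spreadSteps, e0, zero_mul, add_zero, shiftSteps]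
    refine Join.mk_ofSteps_eq _ _ (fun n => ?_) fun j hj => ?_
    · rw [PreJoin.partialSum_ofSteps]
      exact hs n
    · cases j with
      -- At threshold `0` the comparison `0 < 0` fails, so the entry at index `0` is not `g₀`; its
      -- weight is zero.
      | zero =>
        refine absurd ?_ hj
        rw [hs, hs, shiftSteps, shiftSteps]
        exact x.isSteps_partialSum.squeeze.zero
      | succ i =>
        rw [if_pos (by push_cast; rw [zero_mul]; positivity)]
        rfl
  · rw [EG.squeeze_mk]
    have hs : ∀ n, spreadSteps (fun n => squeezeFun (x.partialSum n)) (1 * x.indexBound) n =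
        squeezeFun (x.partialSum n) := fun n => by
      cases n with
      | zero => exact x.isSteps_partialSum.squeeze.zero.symm
      | succ n =>
        simp only [spreadSteps, one_mul]
        rcases le_total (x.partialSum n) (1 / 3) with h | h
        · rw [cut_eq_one (by linarith [PreJoin.le_indexBound h])]
          ring
        · rw [squeezeFun_eq_one h, squeezeFun_eq_one
            (h.trans (x.isSteps_partialSum.mono (Nat.le_succ n)))]
          ring
    refine Join.mk_ofSteps_eq _ _ hs fun j hj => if_neg ?_
    rw [hs, hs] at hj
    rcases le_total (x.partialSum j) (1 / 3) with h | h
    · linarith [PreJoin.le_indexBound h]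
    · rw [squeezeFun_eq_one h, squeezeFun_eq_one
        (h.trans (x.isSteps_partialSum.mono (Nat.le_succ j)))] at hj
      exact absurd rfl hj

/-- `EG` is smoothly contractible. -/
theorem EG.contractible (g₀ : G) :
    DHomotopic (fun _ : EG G => Join.mk (PreJoin.ofSteps _ isSteps_unitSteps fun _ => g₀))
      fun e => e :=
  -- The chain is: constant map, shift after squeeze, squeeze, identity.
  (((EG.homotopic_shift g₀).comp_right EG.homotopic_squeeze.dSmooth_right).trans
    (EG.shift_squeeze_homotopic g₀)).trans EG.homotopic_squeeze.symm

end Contraction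

/-! ### Paths in `EG` over loops in `BG` -/

theorem EG.smul_right_injective {G : Type u} [Group G] {g h : G} {e : EG G}
    (he : g • e = h • e) : g = h := by
  have : (h⁻¹ * g) • e = e := by rw [mul_smul, he, inv_smul_smul]
  exact (inv_mul_eq_one.1 (EG.eq_one_of_smul_eq this)).symm

/-- The coarsest diffeology for which a given map is smooth. -/
@[reducible]
def pullbackDiffeology {X Y : Type*} [DiffeologicalSpace Y] (f : X → Y) :
    DiffeologicalSpace X where
  plots n := {p | IsPlot fun r => f (p r)}
  constant_plots x := isPlot_const
  plot_reparam hp hf := isPlot_reparam hp hf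
  locality {n p} hp := by
    refine DiffeologicalSpace.locality (p := fun r => f (p r)) fun r => ?_
    obtain ⟨U, hU, hr, h⟩ := hp r
    exact ⟨U, hU, hr, fun {m f} hf hfs => h hf hfs⟩

section Paths

variable {G : Type u} [Group G] [DiffeologicalSpace G]

variable (G) in
/-- The smooth paths in `G` that start at the neutral element. -/
@[ext]
structure PathGroup : Type u where
  toFun : ℝ → G
  smooth : DSmooth toFun
  source : toFun 0 = 1

instance : DiffeologicalSpace (PathGroup G) :=
  pullbackDiffeology fun α => (⟨α.toFun, α.smooth⟩ : SmoothPath G)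

/-- The smooth paths in `EG` from `e₀` to a point of the fibre of `e₀`. -/
@[ext]
structure LiftPath (e₀ : EG G) : Type u where
  toFun : ℝ → EG G
  smooth : DSmooth toFun
  source : toFun 0 = e₀
  target : EG.proj (toFun 1) = EG.proj e₀

instance (e₀ : EG G) : DiffeologicalSpace (LiftPath e₀) :=
  pullbackDiffeology fun γ => (⟨γ.toFun, γ.smooth⟩ : SmoothPath (EG G))

theorem PathGroup.dSmooth_iff {A : Type*} [DiffeologicalSpace A] {Γ : A → PathGroup G} :
    DSmooth Γ ↔ DSmooth fun q : A × ℝ => (Γ q.1).toFun q.2 :=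
  SmoothPath.dSmooth_iff (Γ := fun a => ⟨(Γ a).toFun, (Γ a).smooth⟩)

theorem LiftPath.dSmooth_iff {e₀ : EG G} {A : Type*} [DiffeologicalSpace A]
    {Γ : A → LiftPath e₀} : DSmooth Γ ↔ DSmooth fun q : A × ℝ => (Γ q.1).toFun q.2 :=
  SmoothPath.dSmooth_iff (Γ := fun a => ⟨(Γ a).toFun, (Γ a).smooth⟩)

@[fun_prop]
theorem DSmooth.pathGroup_apply {A : Type*} [DiffeologicalSpace A] {Γ : A → PathGroup G}
    {t : A → ℝ} (hΓ : DSmooth Γ) (ht : DSmooth t) : DSmooth fun a => (Γ a).toFun (t a) :=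
  (PathGroup.dSmooth_iff.1 hΓ).comp (dSmooth_id.prodMk ht)

@[fun_prop]
theorem DSmooth.liftPath_apply {e₀ : EG G} {A : Type*} [DiffeologicalSpace A]
    {Γ : A → LiftPath e₀} {t : A → ℝ} (hΓ : DSmooth Γ) (ht : DSmooth t) :
    DSmooth fun a => (Γ a).toFun (t a) :=
  (LiftPath.dSmooth_iff.1 hΓ).comp (dSmooth_id.prodMk ht)

/-- The loop in `BG` below a path in `EG`. -/
def LiftPath.toLoop {e₀ : EG G} (γ : LiftPath e₀) : Loops (EG.proj e₀) where
  toFun t := EG.proj (γ.toFun t)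
  smooth := EG.dSmooth_proj.comp γ.smooth
  source := by rw [γ.source]
  target := γ.target

/-- The constant path. -/
def LiftPath.const (e₀ : EG G) : LiftPath e₀ := ⟨fun _ => e₀, dSmooth_const, rfl, rfl⟩

theorem LiftPath.toLoop_const (e₀ : EG G) :
    (LiftPath.const e₀).toLoop = Loops.const (EG.proj e₀) := rfl

theorem LiftPath.dSmooth_toLoop {e₀ : EG G} : DSmooth (LiftPath.toLoop (e₀ := e₀)) :=
  Loops.dSmooth_iff.2 (EG.dSmooth_proj.comp (LiftPath.dSmooth_iff.1 dSmooth_id))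

/-- The group element that carries the initial point of a path to its end point. -/
def LiftPath.holonomy {e₀ : EG G} (γ : LiftPath e₀) : G := (EG.proj_eq_iff.1 γ.target).choose

theorem LiftPath.holonomy_smul {e₀ : EG G} (γ : LiftPath e₀) : γ.holonomy • e₀ = γ.toFun 1 :=
  (EG.proj_eq_iff.1 γ.target).choose_spec

theorem LiftPath.holonomy_eq {e₀ : EG G} {γ : LiftPath e₀} {g : G} (h : g • e₀ = γ.toFun 1) :
    γ.holonomy = g :=
  EG.smul_right_injective (γ.holonomy_smul.trans h.symm)

theorem LiftPath.holonomy_const (e₀ : EG G) : (LiftPath.const e₀).holonomy = 1 :=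
  LiftPath.holonomy_eq (one_smul _ _)

variable [DiffeologicalGroup G]

instance : Group (PathGroup G) where
  mul α β := ⟨fun t => α.toFun t * β.toFun t, α.smooth.group_mul β.smooth,
    by rw [α.source, β.source, one_mul]⟩
  one := ⟨fun _ => 1, dSmooth_const, rfl⟩
  inv α := ⟨fun t => (α.toFun t)⁻¹, α.smooth.group_inv, by rw [α.source, inv_one]⟩
  mul_assoc _ _ _ := PathGroup.ext <| funext fun _ => mul_assoc _ _ _
  one_mul _ := PathGroup.ext <| funext fun _ => one_mul _
  mul_one _ := PathGroup.ext <| funext fun _ => mul_one _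
  inv_mul_cancel _ := PathGroup.ext <| funext fun _ => inv_mul_cancel _

instance : DiffeologicalGroup (PathGroup G) where
  smooth_mul := PathGroup.dSmooth_iff.2
    (DSmooth.group_mul (f := fun q : (PathGroup G × PathGroup G) × ℝ => q.1.1.toFun q.2)
      (g := fun q => q.1.2.toFun q.2) (by fun_prop) (by fun_prop))
  smooth_inv := PathGroup.dSmooth_iff.2
    (DSmooth.group_inv (f := fun q : PathGroup G × ℝ => q.1.toFun q.2) (by fun_prop))

theorem PathGroup.pointedContractible : PointedContractible (PathGroup G) := by
  refine ⟨fun q => ⟨fun t => q.1.toFun (q.2 * t), q.1.smooth.comp (by fun_prop), ?_⟩,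
    PathGroup.dSmooth_iff.2 ?_, fun α => ?_, fun α => ?_, fun s => rfl⟩
  · rw [mul_zero, q.1.source]
  · fun_prop
  · refine PathGroup.ext <| funext fun t => ?_
    simp only [zero_mul]
    exact α.source
  · refine PathGroup.ext <| funext fun t => ?_
    simp only [one_mul]

instance (e₀ : EG G) : MulAction (PathGroup G) (LiftPath e₀) where
  smul α γ := ⟨fun t => α.toFun t • γ.toFun t,
    EG.dSmooth_smul.comp' (α.smooth.prodMk γ.smooth), by rw [α.source, γ.source, one_smul],
    by rw [EG.proj_smul, γ.target]⟩
  one_smul _ := LiftPath.ext <| funext fun _ => one_smul _ _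
  mul_smul _ _ _ := LiftPath.ext <| funext fun _ => mul_smul _ _ _

/-- Only the initial point of a lifted path has to be corrected, by a translation constant in time;
the end point is free in the fibre. Accordingly the structure group imposes no condition at time
`1`. -/
theorem LiftPath.isPrincipal_toLoop (e₀ : EG G) :
    IsPrincipal (PathGroup G) (LiftPath.toLoop (e₀ := e₀)) where
  smooth_smul := LiftPath.dSmooth_iff.2 (EG.dSmooth_smul.comp'
    (f := fun q : (PathGroup G × LiftPath e₀) × ℝ => (q.1.1.toFun q.2, q.1.2.toFun q.2))
    (by fun_prop))
  smooth := LiftPath.dSmooth_toLoop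
  map_smul α γ := Loops.ext (funext fun t => EG.proj_smul _ _)
  free α γ h := PathGroup.ext <| funext fun t => EG.eq_one_of_smul_eq
    (congrArg (fun γ : LiftPath e₀ => γ.toFun t) h)
  lift n p hp := by
    have hP := EG.isPrincipal_proj G
    obtain ⟨q, hq, hqp⟩ := hP.lift_of_normed (Loops.dSmooth_iff.1 hp.dSmooth)
    obtain ⟨α, hα, hα'⟩ := hP.div_of_normed (q := fun r => q (r, 0)) (q' := fun _ => e₀)
      (hq.comp (by fun_prop)) dSmooth_const fun r => by rw [hqp, (p r).source]
    have hF : DSmooth fun q' : EuclideanSpace ℝ (Fin n) × ℝ => α q'.1 • q q' :=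
      EG.dSmooth_smul.comp' ((hα.comp dSmooth_fst).prodMk hq)
    refine ⟨fun r => ⟨fun t => α r • q (r, t), hF.comp' (f := fun t : ℝ => (r, t))
      (dSmooth_const.prodMk dSmooth_id'), (hα' r).symm, ?_⟩,
      DSmooth.isPlot (LiftPath.dSmooth_iff.2 hF), fun r => Loops.ext (funext fun t => ?_)⟩
    · rw [EG.proj_smul, hqp, (p r).target]
    · exact (EG.proj_smul _ _).trans (hqp (r, t))
  div n q q' hq hq' h := by
    obtain ⟨α, hα, hα'⟩ := (EG.isPrincipal_proj G).div_of_normed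
      (LiftPath.dSmooth_iff.1 hq.dSmooth) (LiftPath.dSmooth_iff.1 hq'.dSmooth)
      fun r => congrFun (congrArg Loops.toFun (h r.1)) r.2
    refine ⟨fun r => ⟨fun t => α (r, t), hα.comp (by fun_prop), ?_⟩,
      DSmooth.isPlot (PathGroup.dSmooth_iff.2 hα),
      fun r => LiftPath.ext <| funext fun t => hα' (r, t)⟩
    have := hα' (r, 0)
    rw [(q r).source, (q' r).source] at this
    exact EG.eq_one_of_smul_eq this.symm

/-- Holonomy is defined by choice, but freeness identifies it along a plot with the smooth quotient
of the end points by the constant plot `e₀`. -/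
theorem LiftPath.dSmooth_holonomy {e₀ : EG G} : DSmooth (LiftPath.holonomy (e₀ := e₀)) := by
  intro n p hp
  have h1 : DSmooth fun r => (p r).toFun 1 := by
    have := hp.dSmooth
    fun_prop
  obtain ⟨α, hα, hα'⟩ := EG.exists_plot_smul (q := fun _ => e₀) isPlot_const h1.isPlot
    fun r => (p r).target.symm
  have : LiftPath.holonomy ∘ p = α := funext fun r => LiftPath.holonomy_eq (hα' r).symm
  rwa [this]

/-- A smooth section of the holonomy map, up to homotopy inverse to it. -/
theorem LiftPath.exists_holonomy_inverse (e₀ : EG G) : ∃ s : G → LiftPath e₀, DSmooth s ∧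
    DHomotopic (fun γ => γ) (fun γ => s (LiftPath.holonomy γ)) ∧
    DHomotopic (fun g => g) fun g => LiftPath.holonomy (s g) := by
  obtain ⟨K, hK, k0, k1⟩ := EG.contractible (1 : G)
  have hmid : ∀ {t : ℝ}, 1 / 3 < t → t < 2 / 3 → plateau t = 1 := fun {t} h1 h2 =>
    plateau_eq_one (by nlinarith)
  -- The path assigned to `g` follows the contraction from `e₀` to the cone point, waits there on
  -- `[1/3, 2/3]`, and follows it backwards to `g • e₀`.
  have hS : DSmooth fun q : G × ℝ => if q.2 < 1 / 2 then K (e₀, 1 - plateau q.2) else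
      K (q.1 • e₀, 1 - plateau q.2) := by
    refine dSmooth_glue (c := fun q : G × ℝ => q.2) (by fun_prop) (a := 1 / 3) (b := 2 / 3)
      (by norm_num) (F₁ := fun q => K (e₀, 1 - plateau q.2))
      (F₂ := fun q => K (q.1 • e₀, 1 - plateau q.2)) (hK.comp (by fun_prop))
      (hK.comp (DSmooth.prodMk (EG.dSmooth_smul.comp' (dSmooth_fst.prodMk dSmooth_const))
        (by fun_prop))) (fun q hq => ?_) (fun q hq => ?_)
    · split_ifs with h
      · rfl
      · rw [hmid (by linarith) hq, sub_self, k0, k0]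
    · split_ifs with h
      · rw [hmid hq (by linarith), sub_self, k0, k0]
      · rfl
  let s : G → LiftPath e₀ := fun g => ⟨fun t => if t < 1 / 2 then K (e₀, 1 - plateau t) else
      K (g • e₀, 1 - plateau t), hS.comp' (f := fun t : ℝ => (g, t))
        (dSmooth_const.prodMk dSmooth_id'), by
      rw [if_pos (by norm_num), plateau_zero, sub_zero, k1], by
      rw [if_neg (by norm_num), plateau_one, sub_zero, k1, EG.proj_smul]⟩
  have hs1 : ∀ g, (s g).holonomy = g := fun g => LiftPath.holonomy_eq (by
    simp only [s]
    rw [if_neg (by norm_num), plateau_one, sub_zero, k1])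
  -- The path `γ` is slowed down by `cut` while the contraction is switched on. At the end `γ` moves
  -- only on `[1/3, 2/3]`, where everything is at the cone point, so only its end points matter.
  have hM : DSmooth fun q : (LiftPath e₀ × ℝ) × ℝ => K (q.1.1.toFun
      ((1 - q.1.2) * q.2 + q.1.2 * cut q.2), (1 - q.1.2) + q.1.2 * (1 - plateau q.2)) :=
    hK.comp (by fun_prop)
  refine ⟨s, LiftPath.dSmooth_iff.2 hS, ⟨fun q => ⟨fun t => K (q.1.toFun
    ((1 - q.2) * t + q.2 * cut t), (1 - q.2) + q.2 * (1 - plateau t)),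
    hM.comp' (f := fun t : ℝ => (q, t)) (dSmooth_const.prodMk dSmooth_id'), ?_, ?_⟩,
    LiftPath.dSmooth_iff.2 hM, fun γ => LiftPath.ext <| funext fun t => ?_,
    fun γ => LiftPath.ext <| funext fun t => ?_⟩,
    DHomotopic.of_eq dSmooth_id' fun g => (hs1 g).symm⟩
  · rw [plateau_zero, cut_eq_zero (by norm_num), sub_zero, mul_one, sub_add_cancel, k1, mul_zero,
      mul_zero, add_zero, q.1.source]
  · rw [plateau_one, cut_eq_one (by norm_num), sub_zero, mul_one, mul_one, sub_add_cancel, k1,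
      q.1.target]
  · simp [k1]
  · simp only [s, sub_self, zero_mul, zero_add, one_mul]
    split_ifs with h
    · rcases le_or_gt t (1 / 3) with h' | h'
      · rw [cut_eq_zero h', γ.source]
      · rw [hmid h' (by linarith), sub_self, k0, k0]
    · rcases lt_or_ge t (2 / 3) with h' | h'
      · rw [hmid (by linarith) h', sub_self, k0, k0]
      · rw [cut_eq_one h', γ.holonomy_smul]

theorem LiftPath.toLoop_bijective (n : ℕ) (e₀ : EG G) :
    Function.Bijective (HomotopyPi.map n LiftPath.dSmooth_toLoop (LiftPath.toLoop_const e₀)) :=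
  (LiftPath.isPrincipal_toLoop e₀).homotopyPi_bijective n PathGroup.pointedContractible _

theorem LiftPath.holonomy_bijective (n : ℕ) (e₀ : EG G) :
    Function.Bijective (HomotopyPi.map n LiftPath.dSmooth_holonomy
      (LiftPath.holonomy_const e₀)) := by
  obtain ⟨s, hs, h1, h2⟩ := LiftPath.exists_holonomy_inverse e₀
  exact HomotopyPi.map_bijective_of_homotopyEquiv n _ hs h1 h2 _

/-- The lift of a concatenation of loops. -/
def LiftPath.concat {e₀ : EG G} (γ δ : LiftPath e₀) : LiftPath e₀ :=
  have hδ : DSmooth fun t => γ.holonomy • δ.toFun t :=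
    EG.dSmooth_smul.comp' (dSmooth_const.prodMk δ.smooth)
  have h : γ.toFun 1 = γ.holonomy • δ.toFun 0 := by rw [δ.source, γ.holonomy_smul]
  ⟨fun t => joinPath γ.toFun (fun t => γ.holonomy • δ.toFun t) (2 * t),
    (joinPath_dSmooth γ.smooth hδ h).comp (by fun_prop), by
    rw [joinPath_of_lt h (by norm_num), cut_eq_zero (by norm_num), γ.source], by
    rw [joinPath_of_gt h (by norm_num), cut_eq_one (by norm_num), EG.proj_smul, δ.target]⟩

theorem LiftPath.toLoop_concat {e₀ : EG G} (γ δ : LiftPath e₀) :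
    (γ.concat δ).toLoop = γ.toLoop.concat δ.toLoop := by
  ext t
  change EG.proj (joinPath γ.toFun (fun t => γ.holonomy • δ.toFun t) (2 * t)) =
    joinPath (fun t => EG.proj (γ.toFun t)) (fun t => EG.proj (δ.toFun t)) (2 * t)
  unfold joinPath
  split_ifs
  · rfl
  · exact EG.proj_smul _ _

/-- The second path is translated by the holonomy of the first, so its end is the iterated translate
of `e₀`. Since the action is a left action, the order of the factors is preserved. -/
theorem LiftPath.holonomy_concat {e₀ : EG G} (γ δ : LiftPath e₀) :
    (γ.concat δ).holonomy = γ.holonomy * δ.holonomy := by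
  refine LiftPath.holonomy_eq (γ := γ.concat δ) ?_
  have h : γ.toFun 1 = γ.holonomy • δ.toFun 0 := by rw [δ.source, γ.holonomy_smul]
  change _ = joinPath γ.toFun (fun t => γ.holonomy • δ.toFun t) (2 * 1)
  rw [joinPath_of_gt h (by norm_num), cut_eq_one (by norm_num), ← δ.holonomy_smul, mul_smul]

/-- The fundamental group of `BG` is the group of components of `G`. -/
theorem BG.nonempty_piOne_mulEquiv (e₀ : EG G) :
    Nonempty (HomotopyPi 1 (EG.proj e₀) ≃* PiZero G) := by
  let φ : PiZero (LiftPath e₀) ≃ PiZero (Loops (EG.proj e₀)) :=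
    Equiv.ofBijective _ (LiftPath.toLoop_bijective 0 e₀)
  let ψ : PiZero (LiftPath e₀) ≃ PiZero G :=
    Equiv.ofBijective _ (LiftPath.holonomy_bijective 0 e₀)
  -- No group structure on `π₀` of the path space is needed: both classes are represented by lifted
  -- paths, whose concatenation is compatible with both maps.
  have hmul : ∀ a b, (φ.symm.trans ψ) (a * b) = (φ.symm.trans ψ) a * (φ.symm.trans ψ) b := by
    intro a b
    obtain ⟨a, rfl⟩ := φ.surjective a
    obtain ⟨b, rfl⟩ := φ.surjective b
    induction a using Quotient.inductionOn with | _ a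
    induction b using Quotient.inductionOn with | _ b
    have : φ (Quotient.mk _ a) * φ (Quotient.mk _ b) = φ (Quotient.mk _ (a.concat b)) :=
      congrArg (Quotient.mk _) (LiftPath.toLoop_concat a b).symm
    rw [this]
    have e : ∀ c, ψ (φ.symm (φ c)) = ψ c := fun c => congrArg ψ (φ.symm_apply_apply c)
    have h : ψ (Quotient.mk _ (a.concat b)) = ψ (Quotient.mk _ a) * ψ (Quotient.mk _ b) :=
      congrArg (Quotient.mk _) (LiftPath.holonomy_concat a b)
    exact (e _).trans (h.trans (congrArg₂ (· * ·) (e _) (e _)).symm)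
  exact ⟨{ φ.symm.trans ψ with map_mul' := hmul }⟩

end Paths

/-- A smooth map that induces a bijection on a homotopy group induces an isomorphism. -/
def HomotopyPi.mulEquiv (n : ℕ) {X Y : Type u} [DiffeologicalSpace X] [DiffeologicalSpace Y]
    {f : X → Y} (hf : DSmooth f) {x : X} {y : Y} (h : f x = y)
    (hb : Function.Bijective (HomotopyPi.map (n + 1) hf h)) :
    HomotopyPi (n + 1) x ≃* HomotopyPi (n + 1) y :=
  { Equiv.ofBijective _ hb with map_mul' := HomotopyPi.map_mul n hf h }

/-! ### Change of base point in `G` and the higher homotopy groups. -/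

theorem HomotopyPi.nonempty_mulEquiv_translate {G : Type u} [Group G] [DiffeologicalSpace G]
    [DiffeologicalGroup G] (n : ℕ) (g : G) :
    Nonempty (HomotopyPi (n + 1) (1 : G) ≃* HomotopyPi (n + 1) g) := by
  have hs : ∀ g : G, DSmooth fun h : G => g * h := fun g => dSmooth_const.group_mul dSmooth_id'
  exact ⟨HomotopyPi.mulEquiv n (hs g) (mul_one g)
    (HomotopyPi.map_bijective_of_homotopyEquiv _ (hs g) (hs g⁻¹)
      (DHomotopic.of_eq dSmooth_id' fun x => (inv_mul_cancel_left g x).symm)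
      (DHomotopic.of_eq dSmooth_id' fun x => (mul_inv_cancel_left g x).symm) _)⟩

theorem BG.nonempty_homotopyPi_mulEquiv {G : Type u} [Group G] [DiffeologicalSpace G]
    [DiffeologicalGroup G] (e₀ : EG G) (g : G) (n : ℕ) :
    Nonempty (HomotopyPi (n + 2) (EG.proj e₀) ≃* HomotopyPi (n + 1) g) := by
  obtain ⟨E⟩ := HomotopyPi.nonempty_mulEquiv_translate n g
  -- By definition `πₙ₊₂` of `BG` is `πₙ₊₁` of its loop space, with the same group structure.
  have E₁ : HomotopyPi (n + 1) (LiftPath.const e₀) ≃* HomotopyPi (n + 2) (EG.proj e₀) :=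
    HomotopyPi.mulEquiv n _ _ (LiftPath.toLoop_bijective (n + 1) e₀)
  have E₂ := HomotopyPi.mulEquiv n _ _ (LiftPath.holonomy_bijective (n + 1) e₀)
  exact ⟨(E₁.symm.trans E₂).trans E⟩

end Diffeology

end

theorem propositionp {G : Type*} [Group G] [DiffeologicalSpace G]
    [Diffeology.DiffeologicalGroup G] (b : Diffeology.BG G) (g : G) :
    Nonempty (Diffeology.HomotopyPi 1 b ≃* Diffeology.PiZero G) ∧
      ∀ n : ℕ, Nonempty (Diffeology.HomotopyPi (n + 2) b ≃* Diffeology.HomotopyPi (n + 1) g) := by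
  obtain ⟨e₀, rfl⟩ : ∃ e₀, Diffeology.EG.proj e₀ = b := Quotient.exists_rep b
  exact ⟨Diffeology.BG.nonempty_piOne_mulEquiv e₀,
    Diffeology.BG.nonempty_homotopyPi_mulEquiv e₀ g⟩
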